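/- Let $\mathcal T$ be a finite collection of non-degenerate closed tetrahedra in $\mathbb R^3$ having a common vertex $\mathbf a$, any two distinct ones of which intersect in $\mathbf a$, in a common edge, or in a common face, and let $\omega$ be the interior of $\bigcup_{K\in\mathcal T}K$; assume that $\omega$ contains an open ball around $\mathbf a$. Let $\mathcal F$ be the set of all faces of the elements of $\mathcal T$ (interior and boundary ones), write $(\cdot,\cdot)_S$ and $\|\cdot\|_S$ for the $L^2(S)$ inner product and norm (with surface measure if $S$ is a face; functions in $H^1(\omega)$ are taken on faces in the sense of traces), and put $$H^1_*(\omega)=\{v\in H^1(\omega):(v,1)_\omega=0\},\qquad \mathbf H_*(\mathrm{div},\omega)=\{\mathbf v\in\mathbf H(\mathrm{div},\omega):(\nabla\cdot\mathbf v,v)_\omega+(\mathbf v,\nabla v)_\omega=0\ \ \forall v\in H^1(\omega)\}.$$ Let $p\ge 0$ and let $r_K$ ($K\in\mathcal T$) and $r_F$ ($F\in\mathcal F$) be polynomials of degree at most $p$ on $K$ and on $F$, respectively, such that $$\sum_{K\in\mathcal T}(r_K,1)_K-\sum_{F\in\mathcal F}(r_F,1)_F=0 .$$ Let $\boldsymbol\tau_p$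 be a field on $\omega$ whose restriction to each $K\in\mathcal T$ is a Raviart--Thomas--N\'ed\'elec polynomial, i.e. belongs to $[\mathbb P_p(K)]^3+\mathbb P_p(K)\mathbf x$, and whose normal components on the boundary faces and whose normal jumps across the interior faces are equal to $r_F$, meaning that, with $\nabla_h\cdot$ the elementwise divergence, $$(\nabla_h\cdot\boldsymbol\tau_p,v)_\omega+(\boldsymbol\tau_p,\nabla v)_\omega=\sum_{F\in\mathcal F}(r_F,v)_F\qquad\forall v\in H^1(\omega).$$ Then there is a function $r^{\mathbf a}\in H^1_*(\omega)$ that solves $$(\nabla r^{\mathbf a},\nabla v)_\omega=\sum_{K\in\mathcal T}(r_K,v)_K-\sum_{F\in\mathcal F}(r_F,v)_F\qquad\forall v\in H^1_*(\omega),$$ and for every such $r^{\mathbf a}$, $$\min_{\substack{\mathbf v\in\mathbf H_*(\mathrm{div},\omega)\\ \nabla\cdot\mathbf v|_K=r_K-\nabla\cdot\boldsymbol\tau_p|_K\ \forall K\in\mathcal T}}\|\boldsymbol\tau_p+\mathbf v\|_\omega=\|\nabla r^{\mathbf a}\|_\omega=\max_{\substack{v\in H^1(\omega)\\ \|\nabla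 v\|_\omega=1}}\Big\{\sum_{K\in\mathcal T}(r_K,v)_K-\sum_{F\in\mathcal F}(r_F,v)_F\Big\},$$ where both the minimum and the maximum are attained. -/

import Mathlib

open MeasureTheory Filter Topology
open scoped ContDiff

/-- Three-dimensional Euclidean space. -/
abbrev E3 : Type := EuclideanSpace ℝ (Fin 3)

noncomputable section

/-! ### Sobolev spaces on an open subset of three-space -/

/-- `φ` is a test function on `U`: smooth with compact support contained in `U`. -/
def IsTestFunction (U : Set E3) (φ : E3 → ℝ) : Prop :=
  ContDiff ℝ ∞ φ ∧ HasCompactSupport φ ∧ tsupport φ ⊆ U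

/-- `G` is a square-integrable weak gradient of `v` on `U`. -/
def IsWeakGradient (U : Set E3) (v : E3 → ℝ) (G : E3 → E3) : Prop :=
  MemLp G 2 (volume.restrict U) ∧
    ∀ φ : E3 → ℝ, IsTestFunction U φ →
      ∫ x in U, v x • gradient φ x = -∫ x in U, φ x • G x

/-- `d` is a square-integrable weak divergence of the vector field `w` on `U`. -/
def IsWeakDivergence (U : Set E3) (w : E3 → E3) (d : E3 → ℝ) : Prop :=
  MemLp d 2 (volume.restrict U) ∧
    ∀ φ : E3 → ℝ, IsTestFunction U φ →
      ∫ x in U, inner ℝ (w x) (gradient φ x) = -∫ x in U, d x * φ x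

/-- The space `H¹(U)`. -/
def MemH1 (U : Set E3) (v : E3 → ℝ) : Prop :=
  MemLp v 2 (volume.restrict U) ∧ ∃ G : E3 → E3, IsWeakGradient U v G

/-- The space `H(div, U)`. -/
def MemHdiv (U : Set E3) (w : E3 → E3) : Prop :=
  MemLp w 2 (volume.restrict U) ∧ ∃ d : E3 → ℝ, IsWeakDivergence U w d

open Classical in
/-- The weak gradient (determined almost everywhere on `U`). -/
def weakGrad (U : Set E3) (v : E3 → ℝ) : E3 → E3 :=
  if h : ∃ G : E3 → E3, IsWeakGradient U v G then h.choose else 0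

open Classical in
/-- The weak divergence (determined almost everywhere on `U`). -/
def weakDiv (U : Set E3) (w : E3 → E3) : E3 → ℝ :=
  if h : ∃ d : E3 → ℝ, IsWeakDivergence U w d then h.choose else 0

/-- The `L²(U)` norm. -/
def l2norm {V : Type*} [NormedAddCommGroup V] (U : Set E3) (f : E3 → V) : ℝ :=
  (eLpNorm f 2 (volume.restrict U)).toReal

/-- The space of functions in `H¹(U)` with zero mean. -/
def MemH1ZeroMean (U : Set E3) (v : E3 → ℝ) : Prop :=
  MemH1 U v ∧ ∫ x in U, v x = 0

/-- The space of fields in `H(div, U)` with vanishing normal trace on the boundary of `U`. -/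
def MemHdivZeroNormal (U : Set E3) (w : E3 → E3) : Prop :=
  MemHdiv U w ∧ ∀ v : E3 → ℝ, MemH1 U v →
    (∫ x in U, weakDiv U w x * v x) + ∫ x in U, inner ℝ (w x) (weakGrad U v x) = 0

/-! ### Patches of tetrahedra -/

/-- The closed simplex with the given vertices. -/
def cell (K : Finset E3) : Set E3 := convexHull ℝ (K : Set E3)

/-- `T` is a patch of tetrahedra (each given by its four vertices) around the point `a`,
which completely surrounds `a`. -/
structure IsInteriorPatch (a : E3) (T : Finset (Finset E3)) : Prop where
  card_eq : ∀ K ∈ T, K.card = 4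
  nondegenerate : ∀ K ∈ T, AffineIndependent ℝ ((↑) : K → E3)
  vertex_mem : ∀ K ∈ T, a ∈ K
  /-- Two distinct tetrahedra meet in the simplex spanned by their common vertices, so (`a` being
  one of these) in `a`, in a common edge, or in a common face. -/
  inter_eq : ∀ K ∈ T, ∀ L ∈ T, K ≠ L →
    cell K ∩ cell L = convexHull ℝ ((K : Set E3) ∩ (L : Set E3))
  surrounds : a ∈ interior (⋃ K ∈ T, cell K)

/-- The open set composed of the elements of the patch. -/
def patchDomain (T : Finset (Finset E3)) : Set E3 := interior (⋃ K ∈ T, cell K)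

open Classical in
/-- All faces (interior and boundary ones) of the patch, given by their three vertices. -/
def patchFaces (T : Finset (Finset E3)) : Finset (Finset E3) :=
  T.biUnion fun K => K.powersetCard 3

/-- The surface measure on the triangle with vertices `F`. -/
def faceMeasure (F : Finset E3) : Measure E3 := (Measure.euclideanHausdorffMeasure 2).restrict (cell F)

/-! ### Traces on faces -/

/-- `g ∈ L²(F)` is the trace on the face `F` of `v ∈ H¹(U)`: the limit in `L²(F)` of the
restrictions to `F` of smooth functions converging to `v` in `H¹(U)`. -/
def IsFaceTrace (U : Set E3) (F : Finset E3) (v g : E3 → ℝ) : Prop :=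
  MemLp g 2 (faceMeasure F) ∧
    ∃ φ : ℕ → E3 → ℝ, (∀ n, ContDiff ℝ ∞ (φ n)) ∧
      Tendsto (fun n => eLpNorm (fun x => φ n x - v x) 2 (volume.restrict U)) atTop (𝓝 0) ∧
      Tendsto (fun n => eLpNorm (fun x => gradient (φ n) x - weakGrad U v x) 2
        (volume.restrict U)) atTop (𝓝 0) ∧
      Tendsto (fun n => eLpNorm (fun x => φ n x - g x) 2 (faceMeasure F)) atTop (𝓝 0)

open Classical in
/-- The trace on the face `F` of `v ∈ H¹(U)` (determined almost everywhere on `F`). -/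
def faceTrace (U : Set E3) (F : Finset E3) (v : E3 → ℝ) : E3 → ℝ :=
  if h : ∃ g : E3 → ℝ, IsFaceTrace U F v g then h.choose else 0

/-! ### Polynomial data -/

/-- `f` coincides on `S` with a polynomial of total degree at most `p`. -/
def IsPolyOn (p : ℕ) (S : Set E3) (f : E3 → ℝ) : Prop :=
  ∃ P : MvPolynomial (Fin 3) ℝ, P.totalDegree ≤ p ∧
    ∀ x ∈ S, f x = MvPolynomial.eval (fun i => x i) P

/-- The broken Raviart–Thomas–Nédélec space of order `p`: on each element, `τ` has the form
`q(x) + s(x) x` with `q` a vector and `s` a scalar polynomial of degree at most `p`. -/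
def IsBrokenRTN (p : ℕ) (T : Finset (Finset E3)) (τ : E3 → E3) : Prop :=
  ∀ K ∈ T, ∃ (q : Fin 3 → E3 → ℝ) (s : E3 → ℝ),
    (∀ i, IsPolyOn p (interior (cell K)) (q i)) ∧ IsPolyOn p (interior (cell K)) s ∧
      ∀ x ∈ interior (cell K), ∀ i, τ x i = q i x + s x * x i

/-- The broken divergence: on the interior of each element `K`, the weak divergence there. -/
def brokenDiv (T : Finset (Finset E3)) (τ : E3 → E3) : E3 → ℝ :=
  fun x => ∑ K ∈ T, (interior (cell K)).indicator (weakDiv (interior (cell K)) τ) x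

/-- The sum over all faces `F` of `(r_F, v)_F`. -/
def facePairing (T : Finset (Finset E3)) (rF : Finset E3 → E3 → ℝ) (v : E3 → ℝ) : ℝ :=
  ∑ F ∈ patchFaces T, ∫ x, rF F x * faceTrace (patchDomain T) F v x ∂(faceMeasure F)

/-- The linear form `v ↦ ∑_K (r_K, v)_K - ∑_F (r_F, v)_F`. -/
def patchResidual (T : Finset (Finset E3)) (rK rF : Finset E3 → E3 → ℝ) (v : E3 → ℝ) : ℝ :=
  (∑ K ∈ T, ∫ x in cell K, rK K x * v x) - facePairing T rF v

/-- `τ`, a broken `H(div)` field, has normal components `r_F` on the boundary faces and jumps of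
the normal component `r_F` across the interior faces, in the sense of the Green formula tested
with all of `H¹`. -/
def HasNormalData (T : Finset (Finset E3)) (rF : Finset E3 → E3 → ℝ) (τ : E3 → E3) : Prop :=
  ∀ v : E3 → ℝ, MemH1 (patchDomain T) v →
    (∫ x in patchDomain T, brokenDiv T τ x * v x) +
      ∫ x in patchDomain T, inner ℝ (τ x) (weakGrad (patchDomain T) v x) = facePairing T rF v

/-- `r` is a zero-mean weak solution of the Neumann problem with data `r_K`, `r_F`. -/
def IsNeumannSolution (T : Finset (Finset E3)) (rK rF : Finset E3 → E3 → ℝ) (r : E3 → ℝ) : Prop :=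
  MemH1ZeroMean (patchDomain T) r ∧
    ∀ v : E3 → ℝ, MemH1ZeroMean (patchDomain T) v →
      ∫ x in patchDomain T,
        inner ℝ (weakGrad (patchDomain T) r x) (weakGrad (patchDomain T) v x) =
          patchResidual T rK rF v

end

open scoped Convolution

/-! ### Test functions -/

/-! Write `f` for the glued `rK` minus the broken divergence of `τ`, and `U` for the patch domain.
The Green formula in `HasNormalData` removes the face terms: the residual of `v` is `(f, v) - (τ,
∇v)` (`patchResidual_eq`), a functional given by `L²` data. Hence traces of general `H¹` functions
never have to be estimated, and the Neumann problem is solved by Lax–Milgram on zero-mean functions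
(`exists_neumann_solution`).

Coercivity is the Poincaré inequality on `U` (`IsInteriorPatch.poincare`), a union of convex cells
that need not be convex. It is proved through the double integral `sqOsc` of `|v x - v y|²`. On
convex open sets this is bounded by integrating gradients along segments, then mollifying and
applying Fatou (`sqOsc_le_of_convex`). The bounds are chained through a small ball around `a`, which
lies in `U` and overlaps every tetrahedron (`IsInteriorPatch.oscControlled`).

Compatibility of the data extends the variational equation from zero-mean functions to all of `H¹`.
It is stated with plain face integrals, so the chosen trace of the constant `1` has to be identified
as `1` (`faceTrace_one_ae_eq`), which rests on a weighted trace inequality for smooth functions.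

The extremal identities are then Hilbert space duality. The residual of `v` is `(∇r, ∇v)`, so
Cauchy–Schwarz bounds it by `‖∇r‖` when `‖∇v‖ = 1`, with equality at `r / ‖∇r‖` if `∇r` is nonzero.
The field `w = -∇r - τ` is admissible and gives `τ + w = -∇r`. Every admissible `w` satisfies `(τ +
w, ∇r) = -‖∇r‖²`, so `‖τ + w‖` cannot be smaller than `‖∇r‖`. -/

lemma gradient_eq_toDual_symm (f : E3 → ℝ) :
    gradient f = fun x => (InnerProductSpace.toDual ℝ E3).symm (fderiv ℝ f x) := rfl

lemma ContDiff.continuous_gradient_of_smooth {f : E3 → ℝ} (hf : ContDiff ℝ ∞ f) :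
    Continuous (gradient f) := by
  rw [gradient_eq_toDual_symm]
  exact (LinearIsometryEquiv.continuous _).comp (hf.continuous_fderiv (by simp))

lemma IsTestFunction.mono {U V : Set E3} {φ : E3 → ℝ} (h : IsTestFunction U φ) (hUV : U ⊆ V) :
    IsTestFunction V φ := ⟨h.1, h.2.1, h.2.2.trans hUV⟩

lemma IsTestFunction.eq_zero_of_notMem {U : Set E3} {φ : E3 → ℝ} (h : IsTestFunction U φ)
    {x : E3} (hx : x ∉ U) : φ x = 0 :=
  image_eq_zero_of_notMem_tsupport fun h' => hx (h.2.2 h')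

lemma IsTestFunction.gradient_eq_zero_of_notMem {U : Set E3} {φ : E3 → ℝ}
    (h : IsTestFunction U φ) {x : E3} (hx : x ∉ U) : gradient φ x = 0 := by
  have : fderiv ℝ φ x = 0 := fderiv_of_notMem_tsupport ℝ (fun h' => hx (h.2.2 h'))
  simp [gradient, this]

lemma IsTestFunction.hasCompactSupport_gradient {U : Set E3} {φ : E3 → ℝ}
    (h : IsTestFunction U φ) : HasCompactSupport (gradient φ) := by
  rw [gradient_eq_toDual_symm]
  exact (h.2.1.fderiv (𝕜 := ℝ)).comp_left (g := (InnerProductSpace.toDual ℝ E3).symm) (map_zero _)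

lemma IsTestFunction.memLp {U : Set E3} {φ : E3 → ℝ} (h : IsTestFunction U φ)
    (p : ENNReal) (μ : Measure E3) [IsFiniteMeasureOnCompacts μ] : MemLp φ p μ :=
  h.1.continuous.memLp_of_hasCompactSupport h.2.1

lemma IsTestFunction.memLp_gradient {U : Set E3} {φ : E3 → ℝ} (h : IsTestFunction U φ)
    (p : ENNReal) (μ : Measure E3) [IsFiniteMeasureOnCompacts μ] : MemLp (gradient φ) p μ :=
  h.1.continuous_gradient_of_smooth.memLp_of_hasCompactSupport h.hasCompactSupport_gradient

/-- An `L²` function that is orthogonal to all test functions vanishes. -/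
lemma ae_eq_zero_of_forall_isTestFunction {V : Type*} [NormedAddCommGroup V] [NormedSpace ℝ V]
    [CompleteSpace V] {U : Set E3} (hU : IsOpen U) {f : E3 → V} (hf : MemLp f 2 (volume.restrict U))
    (h : ∀ φ, IsTestFunction U φ → ∫ x in U, φ x • f x = 0) : f =ᵐ[volume.restrict U] 0 := by
  have hloc : LocallyIntegrableOn f U volume :=
    locallyIntegrableOn_of_locallyIntegrable_restrict (hf.locallyIntegrable one_le_two)
  have := hU.ae_eq_zero_of_integral_contDiff_smul_eq_zero hloc (fun g h1 h2 h3 => by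
    have hg : IsTestFunction U g := ⟨h1, h2, h3⟩
    rw [← h g hg, setIntegral_eq_integral_of_forall_compl_eq_zero]
    intro x hx
    simp [hg.eq_zero_of_notMem hx])
  rw [EventuallyEq, ae_restrict_iff' hU.measurableSet]
  simpa using this

/-! ### Weak gradients and divergences -/

lemma MeasureTheory.MemLp.integrable_smul_two {V : Type*} [NormedAddCommGroup V] [NormedSpace ℝ V]
    {μ : Measure E3} {f : E3 → ℝ} {g : E3 → V} (hf : MemLp f 2 μ) (hg : MemLp g 2 μ) :
    Integrable (fun x => f x • g x) μ :=
  memLp_one_iff_integrable.1 (hg.smul hf)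

lemma MeasureTheory.MemLp.integrable_inner_two
    {μ : Measure E3} {f g : E3 → E3} (hf : MemLp f 2 μ) (hg : MemLp g 2 μ) :
    Integrable (fun x => inner ℝ (f x) (g x)) μ := by
  have h1 : Integrable (fun x => ‖f x‖ * ‖g x‖) μ := hf.norm.integrable_mul hg.norm
  refine h1.mono (hf.1.inner hg.1) (Eventually.of_forall fun x => ?_)
  simpa using abs_real_inner_le_norm (f x) (g x)

lemma IsWeakGradient.ae_eq {U : Set E3} (hU : IsOpen U) {v : E3 → ℝ} {G G' : E3 → E3}
    (h : IsWeakGradient U v G) (h' : IsWeakGradient U v G') : G =ᵐ[volume.restrict U] G' := by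
  have := ae_eq_zero_of_forall_isTestFunction hU (h.1.sub h'.1) (fun φ hφ => by
    have h2 := (hφ.memLp 2 (volume.restrict U))
    have := (h.2 φ hφ).symm.trans (h'.2 φ hφ)
    simp only [Pi.sub_apply, smul_sub]
    rw [integral_sub (h2.integrable_smul_two h.1) (h2.integrable_smul_two h'.1)]
    rw [neg_inj] at this
    rw [this, sub_self])
  filter_upwards [this] with x hx
  simpa [sub_eq_zero] using hx

lemma IsWeakDivergence.ae_eq {U : Set E3} (hU : IsOpen U) {w : E3 → E3} {d d' : E3 → ℝ}
    (h : IsWeakDivergence U w d) (h' : IsWeakDivergence U w d') : d =ᵐ[volume.restrict U] d' := by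
  have := ae_eq_zero_of_forall_isTestFunction hU (h.1.sub h'.1) (fun φ hφ => by
    have h2 := (hφ.memLp 2 (volume.restrict U))
    have := (h.2 φ hφ).symm.trans (h'.2 φ hφ)
    simp only [Pi.sub_apply, smul_sub]
    rw [integral_sub (h2.integrable_smul_two h.1) (h2.integrable_smul_two h'.1)]
    rw [neg_inj] at this
    simp only [smul_eq_mul, mul_comm (φ _)]
    rw [this, sub_self])
  filter_upwards [this] with x hx
  simpa [sub_eq_zero] using hx

lemma MemH1.isWeakGradient {U : Set E3} {v : E3 → ℝ} (h : MemH1 U v) :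
    IsWeakGradient U v (weakGrad U v) := by
  rw [weakGrad, dif_pos h.2]
  exact h.2.choose_spec

lemma IsWeakGradient.weakGrad_ae_eq {U : Set E3} (hU : IsOpen U) {v : E3 → ℝ} {G : E3 → E3}
    (h : IsWeakGradient U v G) : weakGrad U v =ᵐ[volume.restrict U] G := by
  have : IsWeakGradient U v (weakGrad U v) := by
    have h' : ∃ G : E3 → E3, IsWeakGradient U v G := ⟨G, h⟩
    rw [weakGrad, dif_pos h']
    exact h'.choose_spec
  exact this.ae_eq hU h

lemma IsWeakDivergence.weakDiv_ae_eq {U : Set E3} (hU : IsOpen U) {w : E3 → E3} {d : E3 → ℝ}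
    (h : IsWeakDivergence U w d) : weakDiv U w =ᵐ[volume.restrict U] d := by
  have : IsWeakDivergence U w (weakDiv U w) := by
    have h' : ∃ d : E3 → ℝ, IsWeakDivergence U w d := ⟨d, h⟩
    rw [weakDiv, dif_pos h']
    exact h'.choose_spec
  exact this.ae_eq hU h

/-- The default value `0` is square-integrable as well, so no weak divergence has to exist; this
puts `brokenDiv` in `L²` for any field. -/
lemma memLp_weakDiv (U : Set E3) (w : E3 → E3) : MemLp (weakDiv U w) 2 (volume.restrict U) := by
  rw [weakDiv]
  split_ifs with h
  · exact h.choose_spec.1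
  · exact MemLp.zero'

lemma IsWeakGradient.congr {U : Set E3} {v v' : E3 → ℝ} {G G' : E3 → E3}
    (h : IsWeakGradient U v G) (hv : v =ᵐ[volume.restrict U] v')
    (hG : G =ᵐ[volume.restrict U] G') : IsWeakGradient U v' G' := by
  refine ⟨(memLp_congr_ae hG).1 h.1, fun φ hφ => ?_⟩
  have h1 : ∫ x in U, v' x • gradient φ x = ∫ x in U, v x • gradient φ x :=
    integral_congr_ae (by filter_upwards [hv] with x hx; rw [hx])
  have h2 : ∫ x in U, φ x • G' x = ∫ x in U, φ x • G x :=
    integral_congr_ae (by filter_upwards [hG] with x hx; rw [hx])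
  rw [h1, h2, h.2 φ hφ]

lemma IsWeakGradient.add {U : Set E3} {v v' : E3 → ℝ} {G G' : E3 → E3}
    (hv : MemLp v 2 (volume.restrict U)) (hv' : MemLp v' 2 (volume.restrict U))
    (h : IsWeakGradient U v G) (h' : IsWeakGradient U v' G') :
    IsWeakGradient U (fun x => v x + v' x) (fun x => G x + G' x) := by
  refine ⟨h.1.add h'.1, fun φ hφ => ?_⟩
  have h1 := hφ.memLp 2 (volume.restrict U)
  have h2 := hφ.memLp_gradient 2 (volume.restrict U)
  simp only [add_smul, smul_add]
  rw [integral_add (hv.integrable_smul_two h2) (hv'.integrable_smul_two h2),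
    integral_add (h1.integrable_smul_two h.1) (h1.integrable_smul_two h'.1), h.2 φ hφ, h'.2 φ hφ,
    neg_add]

lemma IsWeakGradient.const_mul {U : Set E3} {v : E3 → ℝ} {G : E3 → E3} (c : ℝ)
    (h : IsWeakGradient U v G) : IsWeakGradient U (fun x => c * v x) (fun x => c • G x) := by
  refine ⟨h.1.const_smul c, fun φ hφ => ?_⟩
  simp only [mul_smul, smul_comm (φ _) c]
  rw [integral_smul, integral_smul, h.2 φ hφ, smul_neg]

lemma Continuous.memLp_restrict_of_isBounded {V : Type*} [NormedAddCommGroup V]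
    [SecondCountableTopology V] {f : E3 → V} (hf : Continuous f) {U : Set E3}
    (hU : Bornology.IsBounded U) (p : ENNReal) : MemLp f p (volume.restrict U) := by
  have hc : IsCompact (closure U) := hU.isCompact_closure
  obtain ⟨C, hC⟩ := hc.exists_bound_of_continuousOn hf.continuousOn
  have : IsFiniteMeasure (volume.restrict (closure U)) :=
    ⟨by simpa using hc.measure_lt_top⟩
  exact (MemLp.of_bound hf.aestronglyMeasurable C
    ((ae_restrict_iff' isClosed_closure.measurableSet).2 (Eventually.of_forall hC))).mono_measure
    (Measure.restrict_mono subset_closure le_rfl)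

/-- The gradient of a smooth function is its weak gradient on bounded sets. -/
lemma isWeakGradient_gradient {f : E3 → ℝ} (hf : ContDiff ℝ ∞ f) {U : Set E3}
    (hU : Bornology.IsBounded U) : IsWeakGradient U f (gradient f) := by
  refine ⟨hf.continuous_gradient_of_smooth.memLp_restrict_of_isBounded hU 2, fun φ hφ => ?_⟩
  rw [setIntegral_eq_integral_of_forall_compl_eq_zero
      (fun x hx => by simp [hφ.gradient_eq_zero_of_notMem hx]),
    setIntegral_eq_integral_of_forall_compl_eq_zero
      (fun x hx => by simp [hφ.eq_zero_of_notMem hx])]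
  have hfc := hf.continuous
  have hgc := hf.continuous_gradient_of_smooth
  have i1 : Integrable (fun x => f x • gradient φ x) :=
    (hfc.smul hφ.1.continuous_gradient_of_smooth).integrable_of_hasCompactSupport
      (hφ.hasCompactSupport_gradient.smul_left)
  have i2 : Integrable (fun x => φ x • gradient f x) :=
    (hφ.1.continuous.smul hgc).integrable_of_hasCompactSupport (hφ.2.1.smul_right)
  have i3 : Integrable (fun x => f x * φ x) :=
    (hfc.mul hφ.1.continuous).integrable_of_hasCompactSupport (hφ.2.1.mul_left)
  -- Pairing with a fixed vector reduces the identity to scalar integration by parts in the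
  -- direction `e`.
  refine ext_inner_left ℝ fun e => ?_
  rw [← integral_inner i1, inner_neg_right, ← integral_inner i2]
  have e1 : ∀ x, inner ℝ e (f x • gradient φ x) = f x * fderiv ℝ φ x e := fun x => by
    rw [inner_smul_right, inner_gradient_right]; simp
  have e2 : ∀ x, inner ℝ e (φ x • gradient f x) = fderiv ℝ f x e * φ x := fun x => by
    rw [inner_smul_right, inner_gradient_right]; simp [mul_comm]
  have j1 := i1.const_inner (𝕜 := ℝ) e
  have j2 := i2.const_inner (𝕜 := ℝ) e
  simp only [e1, e2] at j1 j2 ⊢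
  exact integral_mul_fderiv_eq_neg_fderiv_mul_of_integrable j2 j1 i3
    (fun x _ => hf.differentiable (by simp) x) (fun x _ => hφ.1.differentiable (by simp) x)

lemma memH1_of_contDiff {f : E3 → ℝ} (hf : ContDiff ℝ ∞ f) {U : Set E3}
    (hU : Bornology.IsBounded U) : MemH1 U f :=
  ⟨hf.continuous.memLp_restrict_of_isBounded hU 2, _, isWeakGradient_gradient hf hU⟩

lemma IsTestFunction.memH1 {U : Set E3} {φ : E3 → ℝ} (h : IsTestFunction U φ)
    (hU : Bornology.IsBounded U) : MemH1 U φ := memH1_of_contDiff h.1 hU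

/-- Weak gradients restrict to smaller sets. -/
lemma IsWeakGradient.mono {U V : Set E3} (hVU : V ⊆ U) {v : E3 → ℝ} {G : E3 → E3}
    (h : IsWeakGradient U v G) : IsWeakGradient V v G := by
  refine ⟨h.1.mono_measure (Measure.restrict_mono hVU le_rfl), fun φ hφ => ?_⟩
  have := h.2 φ (hφ.mono hVU)
  have e1 : ∀ W, V ⊆ W → ∫ x in W, v x • gradient φ x = ∫ x, v x • gradient φ x := fun W hW =>
    setIntegral_eq_integral_of_forall_compl_eq_zero
      (fun x hx => by simp [(hφ.mono hW).gradient_eq_zero_of_notMem hx])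
  have e2 : ∀ W, V ⊆ W → ∫ x in W, φ x • G x = ∫ x, φ x • G x := fun W hW =>
    setIntegral_eq_integral_of_forall_compl_eq_zero
      (fun x hx => by simp [(hφ.mono hW).eq_zero_of_notMem hx])
  rw [e1 U hVU, e2 U hVU] at this
  rw [e1 V le_rfl, e2 V le_rfl, this]

lemma MemH1.mono {U V : Set E3} (hVU : V ⊆ U) {v : E3 → ℝ} (h : MemH1 U v) : MemH1 V v :=
  ⟨h.1.mono_measure (Measure.restrict_mono hVU le_rfl), _, h.isWeakGradient.mono hVU⟩

/-! ### Mean oscillations and the Poincaré inequality on convex sets -/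

/-- The double integral of `|v x - v y|²` over `x ∈ S` and `y ∈ S'`. -/
noncomputable def sqOsc (v : E3 → ℝ) (S S' : Set E3) : ENNReal :=
  ∫⁻ x in S, ∫⁻ y in S', ‖v x - v y‖ₑ ^ 2

/-- Cauchy–Schwarz against the constant `1`. -/
lemma sq_lintegral_le {α : Type*} [MeasurableSpace α] {μ : Measure α} {h : α → ENNReal}
    (hh : AEMeasurable h μ) : (∫⁻ a, h a ∂μ) ^ 2 ≤ μ Set.univ * ∫⁻ a, h a ^ 2 ∂μ := by
  have := ENNReal.lintegral_mul_le_Lp_mul_Lq μ Real.HolderConjugate.two_two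
    (aemeasurable_const (b := (1 : ENNReal))) hh
  simp only [Pi.mul_apply, ENNReal.rpow_two, one_pow, one_mul, lintegral_const] at this
  calc _ ≤ ((μ Set.univ) ^ (1 / 2 : ℝ) * (∫⁻ a, h a ^ 2 ∂μ) ^ (1 / 2 : ℝ)) ^ 2 := by gcongr
    _ = _ := by
      rw [mul_pow, ← ENNReal.rpow_natCast, ← ENNReal.rpow_natCast, ← ENNReal.rpow_mul,
        ← ENNReal.rpow_mul]
      simp

lemma enorm_add_sq_le (a b : ℝ) : ‖a + b‖ₑ ^ 2 ≤ 2 * (‖a‖ₑ ^ 2 + ‖b‖ₑ ^ 2) := by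
  calc ‖a + b‖ₑ ^ 2 ≤ (‖a‖ₑ + ‖b‖ₑ) ^ 2 := by gcongr; exact enorm_add_le _ _
    _ ≤ _ := by
      have := ENNReal.rpow_add_le_mul_rpow_add_rpow ‖a‖ₑ ‖b‖ₑ (p := 2) (by norm_num)
      norm_num at this
      exact_mod_cast this

/-- The substitution costs a factor `c⁻³`, at most `8` in dimension three. Keeping `c` away from `0`
is the reason for following segments only up to their midpoints below. -/
lemma lintegral_comp_smul_add_le {g : E3 → ENNReal} (hg : Measurable g) {c : ℝ}
    (hc : 1 / 2 ≤ c) (b : E3) : ∫⁻ x, g (c • x + b) ≤ 8 * ∫⁻ x, g x := by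
  have hc0 : 0 < c := by linarith
  have h1 : ∫⁻ x, g (c • x + b) = ∫⁻ x, g (x + b) ∂(Measure.map (c • ·) (volume : Measure E3)) := by
    rw [lintegral_map (by fun_prop) (by fun_prop)]
  rw [h1, Measure.map_addHaar_smul _ hc0.ne', lintegral_smul_measure, lintegral_add_right_eq_self]
  simp only [finrank_euclideanSpace, Fintype.card_fin, smul_eq_mul]
  gcongr
  rw [show (8 : ENNReal) = ENNReal.ofReal 8 by simp]
  apply ENNReal.ofReal_le_ofReal
  rw [abs_of_pos (by positivity)]
  rw [inv_le_comm₀ (by positivity) (by norm_num)]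
  calc (8 : ℝ)⁻¹ = (1 / 2) ^ 3 := by norm_num
    _ ≤ c ^ 3 := by gcongr

lemma enorm_sub_midpoint_sq_le {f : E3 → ℝ} (hf : ContDiff ℝ ∞ f) (x y : E3) :
    ‖f x - f (x + (1 / 2 : ℝ) • (y - x))‖ₑ ^ 2 ≤
      ‖y - x‖ₑ ^ 2 * ∫⁻ s in Set.Icc (0 : ℝ) (1 / 2), ‖gradient f (x + s • (y - x))‖ₑ ^ 2 := by
  have hc : ContDiff ℝ ∞ (fun s : ℝ => f (x + s • (y - x))) := by fun_prop
  have h1 := enorm_sub_le_lintegral_deriv_of_contDiffOn_Icc (f := fun s : ℝ => f (x + s • (y - x)))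
    (a := 0) (b := 1 / 2) (hc.of_le (by simp)).contDiffOn (by norm_num)
  have hg := hf.continuous_gradient_of_smooth
  have hgm : Measurable (gradient f) := hg.measurable
  have hd : ∀ s : ℝ, ‖deriv (fun s : ℝ => f (x + s • (y - x))) s‖ₑ ≤
      ‖y - x‖ₑ * ‖gradient f (x + s • (y - x))‖ₑ := fun s => by
    have hl : HasDerivAt (fun s : ℝ => x + s • (y - x)) (y - x) s := by
      simpa using ((hasDerivAt_id s).smul_const (y - x)).const_add x
    have := ((hf.differentiable (by simp)) (x + s • (y - x))).hasFDerivAt.comp_hasDerivAt s hl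
    have h3 : deriv (fun s : ℝ => f (x + s • (y - x))) s = _ := this.deriv
    rw [h3, ← inner_gradient_left, mul_comm]
    rw [← ofReal_norm, ← ofReal_norm, ← ofReal_norm,
      ← ENNReal.ofReal_mul (norm_nonneg _)]
    exact ENNReal.ofReal_le_ofReal (norm_inner_le_norm _ _)
  rw [enorm_sub_rev]
  simp only [zero_smul, add_zero] at h1
  calc _ ≤ (∫⁻ s in Set.Icc (0 : ℝ) (1 / 2), ‖y - x‖ₑ * ‖gradient f (x + s • (y - x))‖ₑ) ^ 2 := by
        gcongr
        exact h1.trans (lintegral_mono hd)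
    _ = ‖y - x‖ₑ ^ 2 * (∫⁻ s in Set.Icc (0 : ℝ) (1 / 2), ‖gradient f (x + s • (y - x))‖ₑ) ^ 2 := by
        rw [lintegral_const_mul _ (by fun_prop), mul_pow]
    _ ≤ ‖y - x‖ₑ ^ 2 * ∫⁻ s in Set.Icc (0 : ℝ) (1 / 2), ‖gradient f (x + s • (y - x))‖ₑ ^ 2 := by
        gcongr
        refine (sq_lintegral_le (by fun_prop)).trans ?_
        exact mul_le_of_le_one_left' (by simp)

/-- By convexity the half-segment from `x` stays in `U`, so the gradient may be truncated to `U` and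
the `x`-integral enlarged to the whole space. For fixed `s ≤ 1/2` and `y`, the map `x ↦ (1 - s) x +
s y` has ratio at least `1/2`, and `lintegral_comp_smul_add_le` applies uniformly. -/
lemma lintegral_lintegral_sub_midpoint_le {f : E3 → ℝ} (hf : ContDiff ℝ ∞ f) {U : Set E3}
    (hU : Convex ℝ U) (hUm : MeasurableSet U) {D : ENNReal}
    (hD : ∀ x ∈ U, ∀ y ∈ U, ‖y - x‖ₑ ≤ D) :
    ∫⁻ x in U, ∫⁻ y in U, ‖f x - f (x + (1 / 2 : ℝ) • (y - x))‖ₑ ^ 2 ≤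
      8 * D ^ 2 * volume U * ∫⁻ x in U, ‖gradient f x‖ₑ ^ 2 := by
  have hgm : Measurable (gradient f) := hf.continuous_gradient_of_smooth.measurable
  set g : E3 → ENNReal := U.indicator fun x => ‖gradient f x‖ₑ ^ 2 with hg
  have hgmeas : Measurable g := (by fun_prop : Measurable _).indicator hUm
  have step : ∀ x ∈ U, ∀ y ∈ U, ‖f x - f (x + (1 / 2 : ℝ) • (y - x))‖ₑ ^ 2 ≤
      D ^ 2 * ∫⁻ s in Set.Icc (0 : ℝ) (1 / 2), g (x + s • (y - x)) := fun x hx y hy => by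
    refine (enorm_sub_midpoint_sq_le hf x y).trans ?_
    gcongr ?_ ^ 2 * ?_
    · exact hD x hx y hy
    · refine setLIntegral_mono' measurableSet_Icc fun s hs => ?_
      have : x + s • (y - x) ∈ U := hU.add_smul_sub_mem hx hy ⟨hs.1, by linarith [hs.2]⟩
      rw [hg, Set.indicator_of_mem this]
  have hm3 : Measurable (fun p : (E3 × E3) × ℝ => g (p.1.1 + p.2 • (p.1.2 - p.1.1))) := by fun_prop
  calc _ ≤ ∫⁻ x in U, ∫⁻ y in U, D ^ 2 * ∫⁻ s in Set.Icc (0 : ℝ) (1 / 2), g (x + s • (y - x)) :=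
        setLIntegral_mono' hUm fun x hx => setLIntegral_mono' hUm fun y hy => step x hx y hy
    _ ≤ ∫⁻ y in U, ∫⁻ x, D ^ 2 * ∫⁻ s in Set.Icc (0 : ℝ) (1 / 2), g (x + s • (y - x)) := by
        rw [lintegral_lintegral_swap]
        · exact lintegral_mono fun y => setLIntegral_le_lintegral _ _
        · apply Measurable.aemeasurable
          exact (Measurable.lintegral_prod_right hm3).const_mul _
    _ = ∫⁻ y in U, D ^ 2 * ∫⁻ s in Set.Icc (0 : ℝ) (1 / 2), ∫⁻ x, g (x + s • (y - x)) := by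
        refine lintegral_congr fun y => ?_
        rw [lintegral_const_mul, lintegral_lintegral_swap]
        · apply Measurable.aemeasurable
          exact hm3.comp (by fun_prop : Measurable fun p : E3 × ℝ => ((p.1, y), p.2))
        · exact Measurable.lintegral_prod_right
            (hm3.comp (by fun_prop : Measurable fun p : E3 × ℝ => ((p.1, y), p.2)))
    _ ≤ ∫⁻ y in U, D ^ 2 * (8 * ∫⁻ x, g x) := by
        refine lintegral_mono fun y => ?_
        dsimp only
        gcongr
        calc _ ≤ ∫⁻ s in Set.Icc (0 : ℝ) (1 / 2), 8 * ∫⁻ x, g x := by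
              refine setLIntegral_mono' measurableSet_Icc fun s hs => ?_
              have := lintegral_comp_smul_add_le hgmeas (c := 1 - s) (by linarith [hs.2]) (s • y)
              refine le_trans (le_of_eq ?_) this
              congr with x
              congr 1
              module
          _ ≤ _ := by
              rw [lintegral_const]
              exact mul_le_of_le_one_right' (by simp)
    _ = _ := by
        rw [lintegral_const, hg, lintegral_indicator hUm]
        simp only [Measure.restrict_apply MeasurableSet.univ, Set.univ_inter]
        ring

/-- Compare `f x` and `f y` with the value at their midpoint; by symmetry both halves have the same
double integral, whence the constant `2 * 2 * 8`. -/
lemma sqOsc_le_of_contDiff {f : E3 → ℝ} (hf : ContDiff ℝ ∞ f) {U : Set E3}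
    (hU : Convex ℝ U) (hUm : MeasurableSet U) {D : ENNReal}
    (hD : ∀ x ∈ U, ∀ y ∈ U, ‖y - x‖ₑ ≤ D) :
    sqOsc f U U ≤ 32 * D ^ 2 * volume U * ∫⁻ x in U, ‖gradient f x‖ₑ ^ 2 := by
  have hfm : Measurable f := hf.continuous.measurable
  have h1 := lintegral_lintegral_sub_midpoint_le hf hU hUm hD
  have hm : Measurable (fun p : E3 × E3 => ‖f p.1 - f (p.1 + (1 / 2 : ℝ) • (p.2 - p.1))‖ₑ ^ 2) := by
    fun_prop
  have e : ∀ x y : E3, x + (1 / 2 : ℝ) • (y - x) = y + (1 / 2 : ℝ) • (x - y) := fun x y => by module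
  have hsw : ∫⁻ x in U, ∫⁻ y in U, ‖f y - f (y + (1 / 2 : ℝ) • (x - y))‖ₑ ^ 2 =
      ∫⁻ x in U, ∫⁻ y in U, ‖f x - f (x + (1 / 2 : ℝ) • (y - x))‖ₑ ^ 2 := by
    rw [lintegral_lintegral_swap]
    exact (hm.comp measurable_swap).aemeasurable
  calc _ ≤ ∫⁻ x in U, ∫⁻ y in U, 2 * (‖f x - f (x + (1 / 2 : ℝ) • (y - x))‖ₑ ^ 2 +
          ‖f y - f (y + (1 / 2 : ℝ) • (x - y))‖ₑ ^ 2) := by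
        refine lintegral_mono fun x => lintegral_mono fun y => ?_
        dsimp only
        rw [← enorm_sub_rev (f (y + (1 / 2 : ℝ) • (x - y))) (f y), ← e x y]
        refine le_trans (le_of_eq ?_) (enorm_add_sq_le _ _)
        congr 2
        ring
    _ = 2 * (∫⁻ x in U, ∫⁻ y in U, ‖f x - f (x + (1 / 2 : ℝ) • (y - x))‖ₑ ^ 2) +
        2 * (∫⁻ x in U, ∫⁻ y in U, ‖f y - f (y + (1 / 2 : ℝ) • (x - y))‖ₑ ^ 2) := by
        rw [← mul_add, ← lintegral_add_left (Measurable.lintegral_prod_right hm),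
          ← lintegral_const_mul]
        · refine lintegral_congr fun x => ?_
          rw [← lintegral_add_left (by fun_prop), lintegral_const_mul _ (by fun_prop)]
        · exact (Measurable.lintegral_prod_right hm).add
            (Measurable.lintegral_prod_right (hm.comp measurable_swap))
    _ ≤ _ := by
        rw [hsw, ← two_mul, ← mul_assoc]
        calc _ ≤ 2 * 2 * (8 * D ^ 2 * volume U * ∫⁻ x in U, ‖gradient f x‖ₑ ^ 2) := by gcongr
          _ = _ := by ring

/-! ### Mollification -/

/-- Young's inequality for the convolution of an `L²` field with a normalized bump function. -/
lemma lintegral_sq_normed_convolution_le (φ : ContDiffBump (0 : E3)) {G : E3 → E3}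
    (hG : Measurable G) :
    ∫⁻ x, ‖(φ.normed volume ⋆[ContinuousLinearMap.lsmul ℝ ℝ, volume] G) x‖ₑ ^ 2 ≤
      ∫⁻ x, ‖G x‖ₑ ^ 2 := by
  have hφm : Measurable (fun t => ‖φ.normed volume t‖ₑ) :=
    φ.continuous_normed.measurable.enorm
  -- The bump becomes a probability density, so Young's inequality reduces to Cauchy–Schwarz for
  -- `ν`, Tonelli and translation invariance.
  set ν : Measure E3 := volume.withDensity fun t => ‖φ.normed volume t‖ₑ with hν
  have hν1 : ν Set.univ = 1 := by
    rw [hν, withDensity_apply _ MeasurableSet.univ, Measure.restrict_univ]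
    have h := ofReal_integral_eq_lintegral_ofReal (μ := volume) φ.integrable_normed
      (Eventually.of_forall φ.nonneg_normed)
    rw [φ.integral_normed] at h
    rw [← ENNReal.ofReal_one, h]
    exact lintegral_congr fun t => Real.enorm_of_nonneg (φ.nonneg_normed t)
  have : IsProbabilityMeasure ν := ⟨hν1⟩
  have hpt : ∀ x, ‖(φ.normed volume ⋆[ContinuousLinearMap.lsmul ℝ ℝ, volume] G) x‖ₑ ^ 2 ≤
      ∫⁻ t, ‖G (x - t)‖ₑ ^ 2 ∂ν := fun x => by
    have hGx : Measurable fun t => ‖G (x - t)‖ₑ := by fun_prop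
    calc _ ≤ (∫⁻ t, ‖G (x - t)‖ₑ ∂ν) ^ 2 := by
          gcongr
          rw [hν, lintegral_withDensity_eq_lintegral_mul _ hφm hGx, convolution_lsmul]
          refine (enorm_integral_le_lintegral_enorm _).trans (le_of_eq ?_)
          exact lintegral_congr fun t => enorm_smul _ _
      _ ≤ _ := by
          refine (sq_lintegral_le hGx.aemeasurable).trans_eq ?_
          rw [hν1, one_mul]
  calc _ ≤ ∫⁻ x, ∫⁻ t, ‖G (x - t)‖ₑ ^ 2 ∂ν := lintegral_mono hpt
    _ = ∫⁻ t, (∫⁻ x, ‖G (x - t)‖ₑ ^ 2) ∂ν := by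
        rw [lintegral_lintegral_swap]
        fun_prop
    _ = ∫⁻ t, (∫⁻ x, ‖G x‖ₑ ^ 2) ∂ν := by
        refine lintegral_congr fun t => ?_
        exact lintegral_sub_right_eq_self (fun x => ‖G x‖ₑ ^ 2) t
    _ = _ := by rw [lintegral_const, hν1, mul_one]

/-- Away from the boundary, mollification commutes with taking the weak gradient. -/
lemma gradient_normed_convolution {U : Set E3} (hU : IsOpen U) (φ : ContDiffBump (0 : E3))
    {v : E3 → ℝ} {G : E3 → E3} (hv : MemLp v 2 (volume.restrict U)) (hvl : Integrable (U.indicator v))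
    (h : IsWeakGradient U v G) {x : E3} (hx : Metric.closedBall x φ.rOut ⊆ U) :
    gradient (φ.normed volume ⋆[ContinuousLinearMap.lsmul ℝ ℝ, volume] U.indicator v) x =
      (φ.normed volume ⋆[ContinuousLinearMap.lsmul ℝ ℝ, volume] U.indicator G) x := by
  have hφs : ContDiff ℝ ∞ (φ.normed (volume : Measure E3)) := φ.contDiff_normed
  have hφc : HasCompactSupport (φ.normed (volume : Measure E3)) := φ.hasCompactSupport_normed
  -- The convolution at `x` is the pairing with this reflected bump, whose support lies in the
  -- closed ball assumed to be inside `U`; the weak-gradient identity may therefore be tested with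
  -- it.
  set ψ : E3 → ℝ := fun s => φ.normed volume (x - s) with hψ
  have hψt : IsTestFunction U ψ := by
    refine ⟨hφs.comp (contDiff_const.sub contDiff_id), ?_, ?_⟩
    · exact hφc.comp_homeomorph (Homeomorph.subLeft x)
    · refine (closure_minimal ?_ Metric.isClosed_closedBall).trans hx
      intro s hs
      have : x - s ∈ Function.support (φ.normed (volume : Measure E3)) := hs
      rw [φ.support_normed_eq, mem_ball_zero_iff] at this
      rw [mem_closedBall_iff_norm, norm_sub_rev]
      exact this.le
  have hψg : ∀ s, gradient ψ s = - gradient (φ.normed volume) (x - s) := fun s => by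
    have hd : HasFDerivAt (fun s : E3 => x - s) (-ContinuousLinearMap.id ℝ E3) s :=
      (hasFDerivAt_id s).const_sub x
    have := ((hφs.differentiable (by simp)) (x - s)).hasFDerivAt.comp s hd
    have h2 : fderiv ℝ ψ s = _ := this.fderiv
    simp [gradient, h2]
  refine ext_inner_right ℝ fun e => ?_
  have hd := hφc.hasFDerivAt_convolution_left (ContinuousLinearMap.lsmul ℝ ℝ) (hφs.of_le (by simp))
    (hvl.locallyIntegrable) x
  have hconv := (hφc.fderiv (𝕜 := ℝ)).convolutionExists_left
    ((ContinuousLinearMap.lsmul ℝ ℝ : ℝ →L[ℝ] ℝ →L[ℝ] ℝ).precompL E3)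
    (hφs.continuous_fderiv (by simp)) hvl.locallyIntegrable x
  rw [inner_gradient_left, hd.fderiv, convolution_eq_swap, ContinuousLinearMap.integral_apply]
  · have e1 : ∀ t, (((ContinuousLinearMap.lsmul ℝ ℝ : ℝ →L[ℝ] ℝ →L[ℝ] ℝ).precompL E3)
        (fderiv ℝ (φ.normed volume) (x - t)) (U.indicator v t)) e =
          - inner ℝ (v t • gradient ψ t) e := fun t => by
      by_cases ht : t ∈ U
      · rw [Set.indicator_of_mem ht, hψg, inner_smul_left, inner_neg_left, inner_gradient_left]
        simp [ContinuousLinearMap.precompL_apply, mul_comm]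
      · rw [Set.indicator_of_notMem ht, hψt.gradient_eq_zero_of_notMem ht]
        simp
    simp only [e1]
    have j1 : Integrable (fun t => v t • gradient ψ t) (volume.restrict U) :=
      hv.integrable_smul_two (hψt.memLp_gradient 2 _)
    rw [integral_neg, ← setIntegral_eq_integral_of_forall_compl_eq_zero (s := U)
      (fun t ht => by simp [hψt.gradient_eq_zero_of_notMem ht])]
    simp only [real_inner_comm e]
    have e2 : ∫ t, φ.normed volume (x - t) • U.indicator G t = ∫ t in U, ψ t • G t := by
      rw [← integral_indicator hU.measurableSet]
      refine integral_congr_ae (Eventually.of_forall fun t => ?_)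
      by_cases ht : t ∈ U <;> simp [hψ, ht]
    rw [integral_inner j1, h.2 ψ hψt, convolution_lsmul_swap, inner_neg_right, neg_neg, e2,
      real_inner_comm]
  · have := hconv.integrable_swap
    simpa using this

/-- A point of the ball around `a • x + b • y` is the same combination of `x + w` and `y + w`, with
`w` its offset from the centre. Convexity of this eroded set is needed because the mollified
function has a controlled gradient only there. -/
lemma convex_setOf_closedBall_subset {U : Set E3} (hU : Convex ℝ U) (δ : ℝ) :
    Convex ℝ {x | Metric.closedBall x δ ⊆ U} := by
  intro x hx y hy a b ha hb hab z hz
  set w := z - (a • x + b • y) with hw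
  have hwn : ‖w‖ ≤ δ := by rwa [mem_closedBall_iff_norm] at hz
  have h1 : x + w ∈ U := hx (by simpa [mem_closedBall_iff_norm] using hwn)
  have h2 : y + w ∈ U := hy (by simpa [mem_closedBall_iff_norm] using hwn)
  have := hU h1 h2 ha hb hab
  convert this using 1
  have : a • w + b • w = w := by rw [← add_smul, hab, one_smul]
  calc z = a • x + b • y + w := by rw [hw]; abel
    _ = a • x + b • y + (a • w + b • w) := by rw [this]
    _ = _ := by simp only [smul_add]; abel

lemma isOpen_setOf_closedBall_subset {U : Set E3} (hU : IsOpen U) (δ : ℝ) :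
    IsOpen {x | Metric.closedBall x δ ⊆ U} := by
  rw [Metric.isOpen_iff]
  intro x hx
  obtain ⟨ε, hε, h⟩ := (isCompact_closedBall x δ).exists_thickening_subset_open hU hx
  refine ⟨ε, hε, fun y hy z hz => h ?_⟩
  rw [Metric.mem_thickening_iff]
  refine ⟨z - (y - x), ?_, ?_⟩
  · rw [mem_closedBall_iff_norm] at hz ⊢
    convert hz using 2
    abel
  · rw [dist_eq_norm]
    rw [mem_ball_iff_norm] at hy
    convert hy using 2
    abel

/-- The bounded ratio of radii is what almost everywhere convergence of the mollifications requires.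
-/
lemma exists_seq_contDiffBump : ∃ φ : ℕ → ContDiffBump (0 : E3),
    Tendsto (fun n => (φ n).rOut) atTop (𝓝 0) ∧ ∀ n, (φ n).rOut ≤ 2 * (φ n).rIn := by
  refine ⟨fun n => ⟨1 / (2 * (n + 1)), 1 / (n + 1), by positivity, ?_⟩,
    tendsto_one_div_add_atTop_nhds_zero_nat, fun n => ?_⟩
  · apply one_div_lt_one_div_of_lt <;> linarith [(Nat.cast_nonneg n : (0 : ℝ) ≤ n)]
  · apply le_of_eq
    have : (n : ℝ) + 1 ≠ 0 := by positivity
    simp only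
    field_simp

/-- Fatou's lemma for mean oscillations along an exhaustion. -/
lemma sqOsc_le_of_tendsto {U : Set E3} (hU : MeasurableSet U) {W : ℕ → Set E3}
    (hWm : ∀ n, MeasurableSet (W n)) (hWe : ∀ x ∈ U, ∀ᶠ n in atTop, x ∈ W n)
    {V : ℕ → E3 → ℝ} (hVm : ∀ n, Measurable (V n)) {v : E3 → ℝ}
    (hae : ∀ᵐ x, x ∈ U → Tendsto (fun n => V n x) atTop (𝓝 (v x))) {C : ENNReal}
    (hbound : ∀ n, sqOsc (V n) (W n) (W n) ≤ C) : sqOsc v U U ≤ C := by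
  -- Indicators transfer the varying domains `W n` to one fixed space, where Fatou's lemma can be
  -- used twice.
  set Q : ℕ → E3 → E3 → ENNReal := fun n x y =>
    (W n).indicator (fun x => (W n).indicator (fun y => ‖V n x - V n y‖ₑ ^ 2) y) x with hQ
  have hQm : ∀ n, Measurable (fun p : E3 × E3 => Q n p.1 p.2) := fun n => by
    have : (fun p : E3 × E3 => Q n p.1 p.2) =
        (W n ×ˢ W n).indicator fun p => ‖V n p.1 - V n p.2‖ₑ ^ 2 := by
      ext p
      simp only [hQ, Set.indicator, Set.mem_prod]
      split_ifs <;> simp_all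
    rw [this]
    have := hVm n
    exact (by fun_prop : Measurable _).indicator ((hWm n).prod (hWm n))
  have hQi : ∀ n, ∫⁻ x, ∫⁻ y, Q n x y = sqOsc (V n) (W n) (W n) := fun n => by
    rw [sqOsc, ← lintegral_indicator (hWm n)]
    refine lintegral_congr fun x => ?_
    by_cases hx : x ∈ W n
    · simp only [hQ, Set.indicator_of_mem hx]
      rw [lintegral_indicator (hWm n)]
    · simp [hQ, Set.indicator_of_notMem hx]
  have hlim : ∀ᵐ x, x ∈ U → ∀ᵐ y, y ∈ U →
      ‖v x - v y‖ₑ ^ 2 ≤ liminf (fun n => Q n x y) atTop := by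
    filter_upwards [hae] with x hx hxU
    filter_upwards [hae] with y hy hyU
    specialize hx hxU
    specialize hy hyU
    have ht : Tendsto (fun n => Q n x y) atTop (𝓝 (‖v x - v y‖ₑ ^ 2)) := by
      have := ((ENNReal.continuous_pow 2).tendsto _).comp
        ((continuous_enorm.tendsto _).comp (hx.sub hy))
      refine this.congr' ?_
      filter_upwards [hWe x hxU, hWe y hyU] with n h1 h2
      simp [hQ, h1, h2]
    exact ht.liminf_eq.ge
  calc sqOsc v U U ≤ ∫⁻ x in U, ∫⁻ y in U, liminf (fun n => Q n x y) atTop := by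
        refine lintegral_mono_ae ?_
        rw [ae_restrict_iff' hU]
        filter_upwards [hlim] with x hx hxU
        refine lintegral_mono_ae ?_
        rw [ae_restrict_iff' hU]
        exact hx hxU
    _ ≤ ∫⁻ x, ∫⁻ y, liminf (fun n => Q n x y) atTop :=
        (setLIntegral_le_lintegral _ _).trans
          (lintegral_mono fun x => setLIntegral_le_lintegral _ _)
    _ ≤ ∫⁻ x, liminf (fun n => ∫⁻ y, Q n x y) atTop :=
        lintegral_mono fun x => lintegral_liminf_le fun n => (hQm n).comp measurable_prodMk_left
    _ ≤ liminf (fun n => ∫⁻ x, ∫⁻ y, Q n x y) atTop :=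
        lintegral_liminf_le fun n => (hQm n).lintegral_prod_right
    _ ≤ _ := by
        refine liminf_le_of_le (by isBoundedDefault) fun b hb => ?_
        obtain ⟨n, hn⟩ := hb.exists
        exact hn.trans ((hQi n).le.trans (hbound n))

/-- The Poincaré inequality on bounded convex open sets, in terms of mean oscillations. -/
lemma sqOsc_le_of_convex {U : Set E3} (hU : Convex ℝ U) (hUo : IsOpen U)
    (hUb : Bornology.IsBounded U) {D : ENNReal} (hD : ∀ x ∈ U, ∀ y ∈ U, ‖y - x‖ₑ ≤ D)
    {v : E3 → ℝ} (hv : MemLp v 2 (volume.restrict U)) {G : E3 → E3}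
    (h : IsWeakGradient U v G) :
    sqOsc v U U ≤ 32 * D ^ 2 * volume U * ∫⁻ x in U, ‖G x‖ₑ ^ 2 := by
  -- Young's inequality above is stated for genuinely measurable fields, hence the representative.
  obtain ⟨G', hG'm, hGG'⟩ := h.1.1
  have hint : ∫⁻ x in U, ‖G x‖ₑ ^ 2 = ∫⁻ x, ‖U.indicator G' x‖ₑ ^ 2 := by
    rw [lintegral_congr_ae (g := fun x => ‖G' x‖ₑ ^ 2)
      (by filter_upwards [hGG'] with x hx; rw [hx]), ← lintegral_indicator hUo.measurableSet]
    refine lintegral_congr fun x => ?_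
    by_cases hx : x ∈ U <;> simp [hx]
  have h' : IsWeakGradient U v G' := h.congr (EventuallyEq.refl _ _) hGG'
  have : IsFiniteMeasure (volume.restrict U) := ⟨by simpa using hUb.measure_lt_top⟩
  have hvi : Integrable (U.indicator v) := by
    rw [integrable_indicator_iff hUo.measurableSet]
    exact hv.integrable one_le_two
  obtain ⟨φ, hφ0, hφK⟩ := exists_seq_contDiffBump
  set V : ℕ → E3 → ℝ := fun n =>
    (φ n).normed volume ⋆[ContinuousLinearMap.lsmul ℝ ℝ, volume] U.indicator v with hV
  have hVs : ∀ n, ContDiff ℝ ∞ (V n) := fun n =>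
    (φ n).hasCompactSupport_normed.contDiff_convolution_left _ (φ n).contDiff_normed
      hvi.locallyIntegrable
  have hae : ∀ᵐ x, Tendsto (fun n => V n x) atTop (𝓝 (U.indicator v x)) :=
    ContDiffBump.ae_convolution_tendsto_right_of_locallyIntegrable (K := 2) hφ0
      (Eventually.of_forall hφK) hvi.locallyIntegrable
  set W : ℕ → Set E3 := fun n => {x | Metric.closedBall x (φ n).rOut ⊆ U} with hW
  have hWU : ∀ n, W n ⊆ U := fun n x hx => hx (Metric.mem_closedBall_self (φ n).rOut_pos.le)
  have hWm : ∀ n, MeasurableSet (W n) := fun n =>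
    (isOpen_setOf_closedBall_subset hUo _).measurableSet
  have hWe : ∀ x ∈ U, ∀ᶠ n in atTop, x ∈ W n := fun x hx => by
    obtain ⟨ε, hε, hb⟩ := Metric.isOpen_iff.1 hUo x hx
    filter_upwards [hφ0.eventually (gt_mem_nhds hε)] with n hn
    exact (Metric.closedBall_subset_ball hn).trans hb
  have hbound : ∀ n, sqOsc (V n) (W n) (W n) ≤
      32 * D ^ 2 * volume U * ∫⁻ x in U, ‖G x‖ₑ ^ 2 := fun n => by
    refine (sqOsc_le_of_contDiff (hVs n) (convex_setOf_closedBall_subset hU _) (hWm n)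
      (fun x hx y hy => hD x (hWU n hx) y (hWU n hy))).trans ?_
    gcongr ?_ * ?_
    · gcongr
      exact hWU n
    · rw [hint]
      calc _ = ∫⁻ x in W n, ‖((φ n).normed volume ⋆[ContinuousLinearMap.lsmul ℝ ℝ, volume]
              U.indicator G') x‖ₑ ^ 2 :=
            setLIntegral_congr_fun (hWm n) fun x hx => by
              simp only [hV]
              rw [gradient_normed_convolution hUo (φ n) hv hvi h' hx]
        _ ≤ _ := (setLIntegral_le_lintegral _ _).trans
            (lintegral_sq_normed_convolution_le (φ n)
              (hG'm.measurable.indicator hUo.measurableSet))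
  refine sqOsc_le_of_tendsto hUo.measurableSet hWm hWe (fun n => (hVs n).continuous.measurable) ?_
    hbound
  filter_upwards [hae] with x hx hxU
  rwa [Set.indicator_of_mem hxU] at hx

/-! ### Geometry of patches -/

lemma isCompact_cell (K : Finset E3) : IsCompact (cell K) := K.finite_toSet.isCompact_convexHull ℝ

lemma convex_cell (K : Finset E3) : Convex ℝ (cell K) := convex_convexHull ℝ _

lemma measurableSet_cell (K : Finset E3) : MeasurableSet (cell K) :=
  (isCompact_cell K).isClosed.measurableSet

lemma interior_cell_ae_eq (K : Finset E3) : interior (cell K) =ᵐ[volume] cell K :=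
  interior_ae_eq_of_null_frontier ((convex_cell K).addHaar_frontier volume)

lemma isOpen_patchDomain (T : Finset (Finset E3)) : IsOpen (patchDomain T) := isOpen_interior

lemma isBounded_patchDomain (T : Finset (Finset E3)) : Bornology.IsBounded (patchDomain T) :=
  (T.isCompact_biUnion fun K _ => isCompact_cell K).isBounded.subset interior_subset

lemma interior_cell_subset_patchDomain {T : Finset (Finset E3)} {K : Finset E3} (hK : K ∈ T) :
    interior (cell K) ⊆ patchDomain T :=
  interior_mono (Set.subset_biUnion_of_mem (u := cell) (show K ∈ (T : Set (Finset E3)) from hK))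

lemma patchDomain_ae_le (T : Finset (Finset E3)) :
    (patchDomain T : Set E3) ≤ᵐ[volume] (⋃ K ∈ T, interior (cell K) : Set E3) := by
  have : ∀ᵐ x : E3, ∀ K ∈ T, x ∈ cell K → x ∈ interior (cell K) := by
    refine (eventually_all_finset T).2 fun K _ => ?_
    filter_upwards [(interior_cell_ae_eq K).mem_iff] with x hx
    exact hx.2
  filter_upwards [this] with x hx hxp
  obtain ⟨K, hK, hxK⟩ := Set.mem_iUnion₂.1 (interior_subset hxp)
  exact Set.mem_iUnion₂.2 ⟨K, hK, hx K hK hxK⟩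

lemma restrict_biUnion_finset_le {ι : Type*} (T : Finset ι) (s : ι → Set E3) (μ : Measure E3) :
    μ.restrict (⋃ i ∈ T, s i) ≤ ∑ i ∈ T, μ.restrict (s i) := by
  classical
  induction T using Finset.induction_on with
  | empty => simp
  | insert i T hi ih =>
    rw [Finset.set_biUnion_insert, Finset.sum_insert hi]
    exact (Measure.restrict_union_le _ _).trans (by gcongr)

lemma restrict_patchDomain_le (T : Finset (Finset E3)) :
    (volume : Measure E3).restrict (patchDomain T) ≤
      ∑ K ∈ T, volume.restrict (interior (cell K)) :=
  (Measure.restrict_mono_ae (patchDomain_ae_le T)).trans (restrict_biUnion_finset_le _ _ _)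

lemma restrict_cell_eq (K : Finset E3) :
    (volume : Measure E3).restrict (cell K) = volume.restrict (interior (cell K)) :=
  Measure.restrict_congr_set (interior_cell_ae_eq K).symm

/-- By affine independence a missing vertex lies outside the affine span of `S`, which is thus a
proper subspace and null. -/
lemma volume_convexHull_eq_zero {K : Finset E3} (hK : AffineIndependent ℝ ((↑) : K → E3))
    {S : Set E3} (hS : S ⊂ (K : Set E3)) : volume (convexHull ℝ S) = 0 := by
  obtain ⟨hSK, x, hxK, hxS⟩ := Set.ssubset_iff_exists.1 hS
  have hx := hK.notMem_affineSpan_sdiff ⟨x, hxK⟩ Set.univ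
  have hsub : S ⊆ ((↑) : K → E3) '' (Set.univ \ {⟨x, hxK⟩}) := fun y hy =>
    ⟨⟨y, hSK hy⟩, ⟨trivial, fun h => hxS (by
      have : y = x := congrArg Subtype.val h
      rwa [← this])⟩, rfl⟩
  have hne : affineSpan ℝ S ≠ ⊤ := fun h => hx (by
    have := affineSpan_mono ℝ hsub
    rw [h] at this
    exact this trivial)
  exact measure_mono_null (convexHull_subset_affineSpan S) (Measure.addHaar_affineSubspace _ _ hne)

namespace IsInteriorPatch

variable {a : E3} {T : Finset (Finset E3)}

lemma affineSpan_eq_top (hT : IsInteriorPatch a T) {K : Finset E3} (hK : K ∈ T) :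
    affineSpan ℝ (K : Set E3) = ⊤ := by
  have := (hT.nondegenerate K hK).affineSpan_eq_top_iff_card_eq_finrank_add_one.2
    (by simp [hT.card_eq K hK])
  simpa using this

lemma interior_cell_nonempty (hT : IsInteriorPatch a T) {K : Finset E3} (hK : K ∈ T) :
    (interior (cell K)).Nonempty :=
  interior_convexHull_nonempty_iff_affineSpan_eq_top.2 (hT.affineSpan_eq_top hK)

/-- Consequently every ball around `a` meets every cell in a set of positive volume, the link used
in `IsInteriorPatch.oscControlled`. -/
lemma mem_closure_interior_cell (hT : IsInteriorPatch a T) {K : Finset E3} (hK : K ∈ T) :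
    a ∈ closure (interior (cell K)) := by
  rw [(convex_cell K).closure_interior_eq_closure_of_nonempty_interior
    (hT.interior_cell_nonempty hK)]
  exact subset_closure (subset_convexHull ℝ _ (hT.vertex_mem K hK))

lemma mem_patchDomain (hT : IsInteriorPatch a T) : a ∈ patchDomain T := hT.surrounds

lemma volume_inter_eq_zero (hT : IsInteriorPatch a T) {K L : Finset E3} (hK : K ∈ T)
    (hL : L ∈ T) (hne : K ≠ L) : volume (cell K ∩ cell L) = 0 := by
  rw [hT.inter_eq K hK L hL hne]
  refine volume_convexHull_eq_zero (hT.nondegenerate K hK)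
    ⟨Set.inter_subset_left, fun h => hne ?_⟩
  have : K ⊆ L := fun x hx => (h hx).2
  exact Finset.eq_of_subset_of_card_le this (by rw [hT.card_eq K hK, hT.card_eq L hL])

end IsInteriorPatch

/-! ### The Poincaré inequality on patches -/

lemma measurable_osc {v : E3 → ℝ} (hv : Measurable v) :
    Measurable fun p : E3 × E3 => ‖v p.1 - v p.2‖ₑ ^ 2 := by fun_prop

lemma sqOsc_comm {v : E3 → ℝ} (hv : Measurable v) (S S' : Set E3) :
    sqOsc v S S' = sqOsc v S' S := by
  rw [sqOsc, lintegral_lintegral_swap (measurable_osc hv).aemeasurable]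
  refine lintegral_congr fun x => lintegral_congr fun y => ?_
  rw [enorm_sub_rev]

lemma sqOsc_mono (v : E3 → ℝ) {S S' R R' : Set E3} (h : S ⊆ R) (h' : S' ⊆ R') :
    sqOsc v S S' ≤ sqOsc v R R' :=
  lintegral_mono' (Measure.restrict_mono h le_rfl)
    fun _ => lintegral_mono' (Measure.restrict_mono h' le_rfl) le_rfl

/-- Insert an intermediate value `v z` with `z ∈ M`, use `(s + t)² ≤ 2 (s² + t²)`, and integrate
over all three variables. -/
lemma sqOsc_mul_volume_le {v : E3 → ℝ} (hv : Measurable v) (S S' M : Set E3) :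
    sqOsc v S S' * volume M ≤
      2 * (volume S' * sqOsc v S M + volume S * sqOsc v M S') := by
  have hm := measurable_osc hv
  have h1 : ∀ x, Measurable fun z => ‖v x - v z‖ₑ ^ 2 := fun x => by fun_prop
  have h2 : ∀ y, Measurable fun z => ‖v z - v y‖ₑ ^ 2 := fun x => by fun_prop
  have h4 : Measurable fun y => ∫⁻ z in M, ‖v z - v y‖ₑ ^ 2 := Measurable.lintegral_prod_left hm
  have h5 : Measurable fun x => ∫⁻ z in M, ‖v x - v z‖ₑ ^ 2 := Measurable.lintegral_prod_right hm
  calc sqOsc v S S' * volume M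
      = ∫⁻ x in S, ∫⁻ y in S', ∫⁻ _ in M, ‖v x - v y‖ₑ ^ 2 := by
        simp only [lintegral_const, Measure.restrict_apply MeasurableSet.univ, Set.univ_inter]
        rw [sqOsc, ← lintegral_mul_const _ (Measurable.lintegral_prod_right hm)]
        refine lintegral_congr fun x => ?_
        rw [← lintegral_mul_const _ (h1 x)]
    _ ≤ ∫⁻ x in S, ∫⁻ y in S', ∫⁻ z in M, 2 * (‖v x - v z‖ₑ ^ 2 + ‖v z - v y‖ₑ ^ 2) := by
        refine lintegral_mono fun x => lintegral_mono fun y => lintegral_mono fun z => ?_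
        refine le_trans (le_of_eq ?_) (enorm_add_sq_le _ _)
        congr 2
        ring
    _ = ∫⁻ x in S, 2 * ((∫⁻ z in M, ‖v x - v z‖ₑ ^ 2) * volume S' +
          ∫⁻ y in S', ∫⁻ z in M, ‖v z - v y‖ₑ ^ 2) := by
        refine lintegral_congr fun x => ?_
        have : ∀ y, ∫⁻ z in M, 2 * (‖v x - v z‖ₑ ^ 2 + ‖v z - v y‖ₑ ^ 2) =
            2 * ((∫⁻ z in M, ‖v x - v z‖ₑ ^ 2) + ∫⁻ z in M, ‖v z - v y‖ₑ ^ 2) := fun y => by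
          rw [lintegral_const_mul' _ _ (by simp), lintegral_add_left (h1 x)]
        simp only [this]
        rw [lintegral_const_mul' _ _ (by simp), lintegral_add_left measurable_const]
        simp
    _ = _ := by
        rw [lintegral_const_mul' _ _ (by simp),
          lintegral_add_left (h5.mul_const _), lintegral_mul_const _ h5, lintegral_const,
          lintegral_lintegral_swap (f := fun y z => ‖v z - v y‖ₑ ^ 2)
            (by exact (hm.comp measurable_swap).aemeasurable)]
        simp only [Measure.restrict_apply MeasurableSet.univ, Set.univ_inter]
        rw [sqOsc, sqOsc]
        ring

/-- The oscillation of `H¹(U)` functions between `S` and `S'` is controlled by the gradient. -/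
def OscControlled (U S S' : Set E3) : Prop :=
  ∃ C : ENNReal, C ≠ ⊤ ∧ ∀ v : E3 → ℝ, Measurable v → MemH1 U v →
    sqOsc v S S' ≤ C * ∫⁻ x in U, ‖weakGrad U v x‖ₑ ^ 2

lemma OscControlled.symm {U S S' : Set E3} (h : OscControlled U S S') : OscControlled U S' S := by
  obtain ⟨C, hC, h⟩ := h
  exact ⟨C, hC, fun v hv hv1 => (sqOsc_comm hv S' S).trans_le (h v hv hv1)⟩

lemma OscControlled.mono {U S S' R R' : Set E3} (h : OscControlled U R R') (hS : S ⊆ R)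
    (hS' : S' ⊆ R') : OscControlled U S S' := by
  obtain ⟨C, hC, h⟩ := h
  exact ⟨C, hC, fun v hv hv1 => (sqOsc_mono v hS hS').trans (h v hv hv1)⟩

lemma OscControlled.trans {U S S' M : Set E3} (h : OscControlled U S M) (h' : OscControlled U M S')
    (hM : volume M ≠ 0) (hMt : volume M ≠ ⊤) (hS : volume S ≠ ⊤) (hS' : volume S' ≠ ⊤) :
    OscControlled U S S' := by
  obtain ⟨C, hC, h⟩ := h
  obtain ⟨C', hC', h'⟩ := h'
  refine ⟨2 * (volume S' * C + volume S * C') / volume M,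
    (ENNReal.div_lt_top (ENNReal.mul_ne_top (by simp) (ENNReal.add_ne_top.2
      ⟨ENNReal.mul_ne_top hS' hC, ENNReal.mul_ne_top hS hC'⟩)) hM).ne, fun v hv hv1 => ?_⟩
  rw [div_eq_mul_inv, mul_right_comm, ← div_eq_mul_inv, ENNReal.le_div_iff_mul_le (Or.inl hM)
    (Or.inl hMt)]
  calc _ ≤ _ := sqOsc_mul_volume_le hv S S' M
    _ ≤ 2 * (volume S' * (C * ∫⁻ x in U, ‖weakGrad U v x‖ₑ ^ 2) +
          volume S * (C' * ∫⁻ x in U, ‖weakGrad U v x‖ₑ ^ 2)) := by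
        gcongr
        · exact h v hv hv1
        · exact h' v hv hv1
    _ = _ := by ring

lemma oscControlled_of_convex {U V : Set E3} (hVU : V ⊆ U) (hV : Convex ℝ V) (hVo : IsOpen V)
    (hVb : Bornology.IsBounded V) : OscControlled U V V := by
  have hD : ∀ x ∈ V, ∀ y ∈ V, ‖y - x‖ₑ ≤ ENNReal.ofReal (Metric.diam V) := fun x hx y hy => by
    rw [← ofReal_norm, ← dist_eq_norm]
    exact ENNReal.ofReal_le_ofReal (Metric.dist_le_diam_of_mem hVb hy hx)
  refine ⟨32 * ENNReal.ofReal (Metric.diam V) ^ 2 * volume V,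
    ENNReal.mul_ne_top (ENNReal.mul_ne_top (by simp) (by simp)) hVb.measure_lt_top.ne,
    fun v _ hv1 => ?_⟩
  refine (sqOsc_le_of_convex hV hVo hVb hD (hv1.mono hVU).1 (hv1.isWeakGradient.mono hVU)).trans ?_
  gcongr

/-- A ball around `a` is a common hub: each cell is linked to it through their overlap, and any two
cells through the ball. Adjacency of cells and traces on faces play no role; summing over pairs
covers the domain up to a null set. -/
lemma IsInteriorPatch.oscControlled {a : E3} {T : Finset (Finset E3)} (hT : IsInteriorPatch a T) :
    OscControlled (patchDomain T) (patchDomain T) (patchDomain T) := by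
  obtain ⟨ρ, hρ, hB⟩ := Metric.isOpen_iff.1 (isOpen_patchDomain T) a hT.mem_patchDomain
  have hBB : OscControlled (patchDomain T) (Metric.ball a ρ) (Metric.ball a ρ) :=
    oscControlled_of_convex hB (convex_ball a ρ) Metric.isOpen_ball Metric.isBounded_ball
  have fin : ∀ {S : Set E3}, S ⊆ patchDomain T → volume S ≠ ⊤ := fun h =>
    ((isBounded_patchDomain T).subset h).measure_lt_top.ne
  have hKB : ∀ K ∈ T, OscControlled (patchDomain T) (interior (cell K)) (Metric.ball a ρ) :=
      fun K hK => by
    have hsub := interior_cell_subset_patchDomain hK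
    have hKK : OscControlled (patchDomain T) (interior (cell K)) (interior (cell K)) :=
      oscControlled_of_convex hsub (convex_cell K).interior isOpen_interior
        ((isBounded_patchDomain T).subset hsub)
    have hne : (Metric.ball a ρ ∩ interior (cell K)).Nonempty :=
      mem_closure_iff.1 (hT.mem_closure_interior_cell hK) _ Metric.isOpen_ball
        (Metric.mem_ball_self hρ)
    refine (hKK.mono (S' := Metric.ball a ρ ∩ interior (cell K)) le_rfl Set.inter_subset_right).trans
      (hBB.mono Set.inter_subset_left le_rfl)
      ((Metric.isOpen_ball.inter isOpen_interior).measure_pos volume hne).ne'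
      (fin (Set.inter_subset_left.trans hB)) (fin hsub) (fin hB)
  have hKL : ∀ K ∈ T, ∀ L ∈ T,
      OscControlled (patchDomain T) (interior (cell K)) (interior (cell L)) := fun K hK L hL =>
    (hKB K hK).trans (hKB L hL).symm (Metric.measure_ball_pos volume a hρ).ne' (fin hB)
      (fin (interior_cell_subset_patchDomain hK)) (fin (interior_cell_subset_patchDomain hL))
  choose! C hC hCv using hKL
  refine ⟨∑ K ∈ T, ∑ L ∈ T, C K L, ?_, fun v hv hv1 => ?_⟩
  · exact ENNReal.sum_ne_top.2 fun K hK => ENNReal.sum_ne_top.2 fun L hL => hC K hK L hL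
  · calc _ ≤ ∫⁻ x, ∫⁻ y, ‖v x - v y‖ₑ ^ 2 ∂(∑ L ∈ T, volume.restrict (interior (cell L)))
            ∂(∑ K ∈ T, volume.restrict (interior (cell K))) :=
          lintegral_mono' (restrict_patchDomain_le T) fun x =>
            lintegral_mono' (restrict_patchDomain_le T) le_rfl
      _ = ∑ K ∈ T, ∑ L ∈ T, sqOsc v (interior (cell K)) (interior (cell L)) := by
          simp only [lintegral_finsetSum_measure]
          refine Finset.sum_congr rfl fun K _ => ?_
          rw [lintegral_finsetSum]
          · rfl
          · exact fun L _ => Measurable.lintegral_prod_right (measurable_osc hv)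
      _ ≤ _ := by
          simp only [Finset.sum_mul]
          exact Finset.sum_le_sum fun K hK => Finset.sum_le_sum fun L hL => hCv K hK L hL v hv hv1

/-- Zero mean gives `v x * |U| = ∫ (v x - v y) dy`. Square by Cauchy–Schwarz, cancel one factor
`|U|` and integrate in `x`. -/
lemma volume_mul_lintegral_sq_le_sqOsc {U : Set E3} (hU : volume U ≠ ⊤) (hU0 : volume U ≠ 0)
    {v : E3 → ℝ} (hv : Measurable v) (hvi : IntegrableOn v U) (h0 : ∫ x in U, v x = 0) :
    volume U * ∫⁻ x in U, ‖v x‖ₑ ^ 2 ≤ sqOsc v U U := by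
  have hfin : IsFiniteMeasure (volume.restrict U) := ⟨by simpa using hU.lt_top⟩
  rw [← lintegral_const_mul _ (by fun_prop)]
  refine lintegral_mono fun x => ?_
  have h1 : ∫ y in U, (v x - v y) = v x * (volume U).toReal := by
    rw [integral_sub (integrable_const _) hvi, h0]
    simp [Measure.real, mul_comm]
  have h2 : ‖v x‖ₑ * volume U ≤ ∫⁻ y in U, ‖v x - v y‖ₑ := by
    have := enorm_integral_le_lintegral_enorm (μ := volume.restrict U) fun y => v x - v y
    rw [h1, enorm_mul, Real.enorm_of_nonneg ENNReal.toReal_nonneg, ENNReal.ofReal_toReal hU] at this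
    exact this
  have h3 : (‖v x‖ₑ * volume U) ^ 2 ≤ volume U * ∫⁻ y in U, ‖v x - v y‖ₑ ^ 2 := by
    refine (pow_le_pow_left' h2 2).trans ((sq_lintegral_le (by fun_prop)).trans_eq ?_)
    simp
  have h4 : volume U * (volume U * ‖v x‖ₑ ^ 2) ≤ volume U * ∫⁻ y in U, ‖v x - v y‖ₑ ^ 2 := by
    refine le_trans (le_of_eq ?_) h3
    ring
  exact (ENNReal.mul_le_mul_iff_right hU0 hU).1 h4

/-- The Poincaré inequality for zero-mean functions on a patch. -/
lemma IsInteriorPatch.poincare {a : E3} {T : Finset (Finset E3)} (hT : IsInteriorPatch a T) :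
    ∃ C : ENNReal, C ≠ ⊤ ∧ ∀ (v : E3 → ℝ) (G : E3 → E3), MemLp v 2 (volume.restrict (patchDomain T)) →
      IsWeakGradient (patchDomain T) v G → ∫ x in patchDomain T, v x = 0 →
      ∫⁻ x in patchDomain T, ‖v x‖ₑ ^ 2 ≤ C * ∫⁻ x in patchDomain T, ‖G x‖ₑ ^ 2 := by
  obtain ⟨C, hC, h⟩ := hT.oscControlled
  have hU : volume (patchDomain T) ≠ ⊤ := (isBounded_patchDomain T).measure_lt_top.ne
  have hU0 : volume (patchDomain T) ≠ 0 :=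
    ((isOpen_patchDomain T).measure_pos volume ⟨a, hT.mem_patchDomain⟩).ne'
  have hfin : IsFiniteMeasure (volume.restrict (patchDomain T)) := ⟨by simpa using hU.lt_top⟩
  refine ⟨C / volume (patchDomain T), (ENNReal.div_lt_top hC hU0).ne, fun v G hv hG h0 => ?_⟩
  obtain ⟨v', hv'm, hvv'⟩ := hv.1
  have hv' := (memLp_congr_ae hvv').1 hv
  have hG' := hG.congr hvv' (EventuallyEq.refl _ G)
  have hgrad := hG'.weakGrad_ae_eq (isOpen_patchDomain T)
  have e1 : ∫⁻ x in patchDomain T, ‖v x‖ₑ ^ 2 = ∫⁻ x in patchDomain T, ‖v' x‖ₑ ^ 2 :=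
    lintegral_congr_ae (by filter_upwards [hvv'] with x hx; rw [hx])
  have e2 : ∫⁻ x in patchDomain T, ‖G x‖ₑ ^ 2 =
      ∫⁻ x in patchDomain T, ‖weakGrad (patchDomain T) v' x‖ₑ ^ 2 :=
    lintegral_congr_ae (by filter_upwards [hgrad] with x hx; rw [hx])
  rw [e1, e2, div_eq_mul_inv, mul_right_comm, ← div_eq_mul_inv,
    ENNReal.le_div_iff_mul_le (Or.inl hU0) (Or.inl hU), mul_comm _ (volume _)]
  refine (volume_mul_lintegral_sq_le_sqOsc hU hU0 hv'm.measurable (hv'.integrable one_le_two) ?_).trans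
    (h v' hv'm.measurable ⟨hv', G, hG'⟩)
  rw [← h0]
  exact (integral_congr_ae hvv').symm

/-! ### A weighted trace inequality on faces -/

/-- A plane spanned by a face, parametrized isometrically. -/
structure FaceChart (F : Finset E3) where
  lin : EuclideanSpace ℝ (Fin 2) →ₗᵢ[ℝ] E3
  base : E3
  base_mem : base ∈ F
  cell_subset : ∀ x ∈ cell F, ∃ y, lin y + base = x
  range_le : ∀ y, lin y + base ∈ affineSpan ℝ (F : Set E3)

namespace FaceChart

variable {F : Finset E3}

/-- The parametrization of the plane of a face. -/
noncomputable def map (J : FaceChart F) (y : EuclideanSpace ℝ (Fin 2)) : E3 := J.lin y + J.base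

lemma isometry_map (J : FaceChart F) : Isometry J.map :=
  (IsometryEquiv.addRight J.base).isometry.comp J.lin.isometry

/-- Isometries preserve the Hausdorff measure, which is Lebesgue measure on the Euclidean plane. -/
lemma faceMeasure_eq (J : FaceChart F) :
    faceMeasure F = Measure.map J.map (volume.restrict (J.map ⁻¹' cell F)) := by
  rw [← EuclideanSpace.euclideanHausdorffMeasure_eq_volume,
    ← Measure.restrict_map J.isometry_map.continuous.measurable (measurableSet_cell F),
    J.isometry_map.map_euclideanHausdorffMeasure,
    Measure.restrict_restrict_of_subset]
  · rfl
  · intro x hx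
    obtain ⟨y, hy⟩ := J.cell_subset x hx
    exact ⟨y, hy⟩

lemma isFiniteMeasure_faceMeasure (J : FaceChart F) : IsFiniteMeasure (faceMeasure F) := by
  rw [J.faceMeasure_eq]
  have hc : IsCompact (J.map ⁻¹' cell F) :=
    J.isometry_map.isClosedEmbedding.isCompact_preimage (isCompact_cell F)
  have : IsFiniteMeasure (volume.restrict (J.map ⁻¹' cell F)) := ⟨by simpa using hc.measure_lt_top⟩
  infer_instance

end FaceChart

lemma nonempty_faceChart {F : Finset E3} (hF : AffineIndependent ℝ ((↑) : F → E3))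
    (hc : F.card = 3) : Nonempty (FaceChart F) := by
  obtain ⟨v, hv⟩ : F.Nonempty := Finset.card_pos.1 (by omega)
  have hfin : Module.finrank ℝ (vectorSpan ℝ (F : Set E3)) = 2 := by
    have := hF.finrank_vectorSpan (n := 2) (by simp [hc])
    rwa [show Set.range ((↑) : F → E3) = (F : Set E3) by simp] at this
  have hvs : v ∈ affineSpan ℝ (F : Set E3) := subset_affineSpan ℝ _ hv
  set ob := (stdOrthonormalBasis ℝ (vectorSpan ℝ (F : Set E3))).reindex (finCongr hfin)
  refine ⟨⟨(vectorSpan ℝ (F : Set E3)).subtypeₗᵢ.comp ob.repr.symm.toLinearIsometry, v, hv,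
    fun x hx => ?_, fun y => ?_⟩⟩
  · have hx' := convexHull_subset_affineSpan (F : Set E3) hx
    have hd := AffineSubspace.vsub_mem_direction hx' hvs
    rw [direction_affineSpan] at hd
    refine ⟨ob.repr ⟨x -ᵥ v, hd⟩, ?_⟩
    simp
  · have := (ob.repr.symm y).2
    exact AffineSubspace.vadd_mem_of_mem_direction
      ((direction_affineSpan ℝ (F : Set E3)).symm ▸ this) hvs

/-- Integration over planes parallel to a face. -/
lemma FaceChart.lintegral_lintegral_eq {F : Finset E3} (J : FaceChart F) {d : E3}
    (hd : d ∉ affineSpan ℝ (F : Set E3)) :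
    ∃ c : NNReal, ∀ g : E3 → ENNReal, Measurable g →
      ∫⁻ y, ∫⁻ t : ℝ, g (J.map y + t • (d - J.base)) = c * ∫⁻ x, g x := by
  set e := d - J.base with he
  let Ψ : EuclideanSpace ℝ (Fin 2) × ℝ →ₗ[ℝ] E3 :=
    J.lin.toLinearMap.coprod (LinearMap.toSpanSingleton ℝ E3 e)
  have hΨ : ∀ p, Ψ p = J.lin p.1 + p.2 • e := fun p => by simp [Ψ]
  have hinj : Function.Injective Ψ := by
    rw [← LinearMap.ker_eq_bot, LinearMap.ker_eq_bot']
    rintro ⟨y, t⟩ h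
    rw [hΨ] at h
    have ht : t = 0 := by
      by_contra ht
      apply hd
      have : d = J.lin (-(t⁻¹ • y)) + J.base := by
        have h1 : e = - (t⁻¹ • J.lin y) := by
          have : t • e = - J.lin y := by
            rw [eq_neg_iff_add_eq_zero, add_comm]; exact h
          rw [← smul_neg, ← this, smul_smul, inv_mul_cancel₀ ht, one_smul]
        rw [map_neg, map_smul, ← h1, he, sub_add_cancel]
      rw [this]
      exact J.range_le _
    subst ht
    have : J.lin y = 0 := by simpa using h
    have hy : y = 0 := J.lin.injective (by rw [this, map_zero])
    simp [hy]
  let Φ : (EuclideanSpace ℝ (Fin 2) × ℝ) ≃L[ℝ] E3 :=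
    (LinearMap.linearEquivOfInjective Ψ hinj (by simp)).toContinuousLinearEquiv
  have hΦ : ∀ p, Φ p = J.lin p.1 + p.2 • e := hΨ
  set μ : Measure E3 := Measure.map Φ (volume.prod volume) with hμ
  have hH : μ.IsAddHaarMeasure := ContinuousLinearEquiv.isAddHaarMeasure_map Φ _
  -- Uniqueness of Haar measure supplies the constant, so the Jacobian is never computed.
  obtain ⟨c, hc⟩ : ∃ c : NNReal, μ = c • volume := ⟨_, Measure.isAddLeftInvariant_eq_smul μ volume⟩
  refine ⟨c, fun g hg => ?_⟩
  have hgm : Measurable fun p : EuclideanSpace ℝ (Fin 2) × ℝ => g (Φ p + J.base) :=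
    hg.comp ((Φ.continuous.measurable).add_const _)
  calc _ = ∫⁻ y, ∫⁻ t : ℝ, g (Φ (y, t) + J.base) := by
        refine lintegral_congr fun y => lintegral_congr fun t => ?_
        rw [hΦ, FaceChart.map]
        congr 1
        abel
    _ = ∫⁻ p, g (Φ p + J.base) ∂(volume.prod volume) :=
        (lintegral_prod _ hgm.aemeasurable).symm
    _ = ∫⁻ x, g (x + J.base) ∂μ := by
        rw [hμ, lintegral_map (by fun_prop) Φ.continuous.measurable]
    _ = _ := by
        rw [hc, lintegral_smul_measure, lintegral_add_right_eq_self g]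
        simp [ENNReal.smul_def]

/-- Bound `ψ x` by its value at `x + t • e` plus the derivative along the segment, and integrate
over `t`; `h ≤ 1` absorbs the extra factor on the gradient term. -/
lemma ofReal_mul_enorm_le {ψ : E3 → ℝ} (hψ : ContDiff ℝ ∞ ψ) (x e : E3) {h : ℝ}
    (h1 : h ≤ 1) :
    ENNReal.ofReal h * ‖ψ x‖ₑ ≤ ∫⁻ t in Set.Icc 0 h,
      (‖ψ (x + t • e)‖ₑ + ‖e‖ₑ * ‖gradient ψ (x + t • e)‖ₑ) := by
  have hc : ContDiff ℝ ∞ (fun s : ℝ => ψ (x + s • e)) := by fun_prop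
  have hgm : Measurable (gradient ψ) := hψ.continuous_gradient_of_smooth.measurable
  have hψm : Measurable ψ := hψ.continuous.measurable
  have hd : ∀ s : ℝ, ‖deriv (fun s : ℝ => ψ (x + s • e)) s‖ₑ ≤
      ‖e‖ₑ * ‖gradient ψ (x + s • e)‖ₑ := fun s => by
    have hl : HasDerivAt (fun s : ℝ => x + s • e) e s := by
      simpa using ((hasDerivAt_id s).smul_const e).const_add x
    have := ((hψ.differentiable (by simp)) (x + s • e)).hasFDerivAt.comp_hasDerivAt s hl
    have h3 : deriv (fun s : ℝ => ψ (x + s • e)) s = _ := this.deriv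
    rw [h3, ← inner_gradient_left, mul_comm]
    rw [← ofReal_norm, ← ofReal_norm, ← ofReal_norm, ← ENNReal.ofReal_mul (norm_nonneg _)]
    exact ENNReal.ofReal_le_ofReal (norm_inner_le_norm _ _)
  have hpt : ∀ t ∈ Set.Icc 0 h, ‖ψ x‖ₑ ≤ ‖ψ (x + t • e)‖ₑ +
      ∫⁻ s in Set.Icc 0 h, ‖e‖ₑ * ‖gradient ψ (x + s • e)‖ₑ := fun t ht => by
    have h2 := enorm_sub_le_lintegral_deriv_of_contDiffOn_Icc (f := fun s : ℝ => ψ (x + s • e))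
      (a := 0) (b := t) (hc.of_le (by simp)).contDiffOn ht.1
    simp only [zero_smul, add_zero] at h2
    calc ‖ψ x‖ₑ = ‖ψ (x + t • e) - (ψ (x + t • e) - ψ x)‖ₑ := by rw [sub_sub_cancel]
      _ ≤ ‖ψ (x + t • e)‖ₑ + ‖ψ (x + t • e) - ψ x‖ₑ := enorm_sub_le
      _ ≤ _ := by
        gcongr
        refine h2.trans ((lintegral_mono hd).trans ?_)
        exact lintegral_mono' (Measure.restrict_mono (Set.Icc_subset_Icc_right ht.2) le_rfl) le_rfl
  calc ENNReal.ofReal h * ‖ψ x‖ₑ = ∫⁻ t in Set.Icc 0 h, ‖ψ x‖ₑ := by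
        simp [mul_comm]
    _ ≤ ∫⁻ t in Set.Icc 0 h, (‖ψ (x + t • e)‖ₑ +
          ∫⁻ s in Set.Icc 0 h, ‖e‖ₑ * ‖gradient ψ (x + s • e)‖ₑ) :=
        setLIntegral_mono' measurableSet_Icc hpt
    _ ≤ _ := by
        rw [lintegral_add_left (by fun_prop), lintegral_add_left (by fun_prop), lintegral_const]
        gcongr
        refine mul_le_of_le_one_right' ?_
        simpa using h1

/-- A trace inequality on a face, with a weight that is positive almost everywhere. -/
lemma exists_weighted_trace_inequality {K F : Finset E3} (hK : K.card = 4)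
    (hKi : AffineIndependent ℝ ((↑) : K → E3)) (hFK : F ⊆ K) (hF : F.card = 3) :
    IsFiniteMeasure (faceMeasure F) ∧
    ∃ (w : E3 → ENNReal) (c c' : NNReal), Measurable w ∧ (∀ x, w x ≤ 1) ∧
      (∀ᵐ x ∂(faceMeasure F), w x ≠ 0) ∧ ∀ ψ : E3 → ℝ, ContDiff ℝ ∞ ψ →
        ∫⁻ x, w x * ‖ψ x‖ₑ ∂(faceMeasure F) ≤
          c * ((∫⁻ x in cell K, ‖ψ x‖ₑ) + c' * ∫⁻ x in cell K, ‖gradient ψ x‖ₑ) := by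
  have hFi : AffineIndependent ℝ ((↑) : F → E3) :=
    hKi.comp_embedding ⟨Set.inclusion hFK, Set.inclusion_injective hFK⟩
  obtain ⟨J⟩ := nonempty_faceChart hFi hF
  refine ⟨J.isFiniteMeasure_faceMeasure, ?_⟩
  obtain ⟨d, hdK, hdF⟩ : ∃ d ∈ K, d ∉ F := by
    by_contra! hcon
    have := Finset.card_le_card (show K ⊆ F from hcon)
    omega
  have hd : d ∉ affineSpan ℝ (F : Set E3) := fun hmem => by
    refine hKi.notMem_affineSpan_sdiff ⟨d, hdK⟩ Set.univ (affineSpan_mono ℝ ?_ hmem)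
    intro y hy
    refine ⟨⟨y, hFK hy⟩, ⟨trivial, fun h => hdF ?_⟩, rfl⟩
    have : y = d := congrArg Subtype.val h
    rwa [← this]
  obtain ⟨c, hc⟩ := J.lintegral_lintegral_eq hd
  have htop : affineSpan ℝ (Set.range ((↑) : K → E3)) = ⊤ :=
    hKi.affineSpan_eq_top_iff_card_eq_finrank_add_one.2 (by simp [hK])
  let b : AffineBasis K ℝ E3 := ⟨(↑), hKi, htop⟩
  have hb : ∀ i : K, b i = i := fun _ => rfl
  have hcell : cell K = {x | ∀ i, 0 ≤ b.coord i x} := by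
    rw [← b.convexHull_eq_nonneg_coord, cell]
    congr 1
    exact Subtype.range_coe.symm
  set e := d - J.base with he
  set iv : K := ⟨J.base, hFK J.base_mem⟩ with hiv
  set id' : K := ⟨d, hdK⟩
  have hne : id' ≠ iv := fun h => hdF (by
    have : d = J.base := congrArg Subtype.val h
    rw [this]; exact J.base_mem)
  -- Moving along `e` trades the coordinate of the base vertex for that of the opposite vertex `d`
  -- at unit rate; the other coordinates are unchanged.
  have hmove : ∀ x (t : ℝ) i, b.coord i (x + t • e) =
      b.coord i x + t * (b.coord i (b id') - b.coord i (b iv)) := fun x t i => by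
    rw [add_comm x, ← vadd_eq_add, AffineMap.map_vadd, map_smul, he,
      show d - J.base = b id' -ᵥ b iv from rfl, AffineMap.linearMap_vsub]
    simp [add_comm]
  have hcoordc : ∀ i, Continuous (b.coord i) := fun i =>
    AffineMap.continuous_of_finiteDimensional _
  -- The weight is how far one may move along `e` before the base coordinate becomes negative,
  -- capped at `1` for `ofReal_mul_enorm_le`.
  set w : E3 → ℝ := fun x => min (b.coord iv x) 1 with hw
  have hwc : Continuous w := (hcoordc iv).min continuous_const
  have hsegm : ∀ x ∈ cell F, ∀ t ∈ Set.Icc 0 (w x), x + t • e ∈ cell K := fun x hx t ht => by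
    have hxK : x ∈ cell K := convexHull_mono hFK hx
    rw [hcell] at hxK ⊢
    intro i
    have hxi := hxK i
    rw [hmove, b.coord_apply, b.coord_apply]
    by_cases h1 : i = iv
    · subst h1
      have : t ≤ b.coord iv x := ht.2.trans (min_le_left _ _)
      rw [if_neg hne.symm, if_pos rfl]
      linarith
    · rw [if_neg h1]
      have : 0 ≤ t := ht.1
      split_ifs <;> linarith
  refine ⟨fun x => ENNReal.ofReal (w x), c, ‖e‖₊, hwc.measurable.ennreal_ofReal, fun x => ?_, ?_,
    fun ψ hψ => ?_⟩
  · exact ENNReal.ofReal_le_one.2 (min_le_right (b.coord iv x) 1)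
  · let A : EuclideanSpace ℝ (Fin 2) →ᵃ[ℝ] ℝ := (b.coord iv).comp
      (J.lin.toLinearMap.toAffineMap + AffineMap.const ℝ _ J.base)
    have hA : ∀ y, A y = b.coord iv (J.map y) := fun y => rfl
    -- On the face the weight vanishes only where the base coordinate does. In the chart this is an
    -- affine subspace, proper since the base vertex has coordinate `1`, hence null.
    let Z : AffineSubspace ℝ (EuclideanSpace ℝ (Fin 2)) := (AffineSubspace.mk' (0 : ℝ) ⊥).comap A
    have hZ : ∀ y, y ∈ Z ↔ b.coord iv (J.map y) = 0 := fun y => by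
      rw [AffineSubspace.mem_comap, AffineSubspace.mem_mk', hA]
      simp
    have hZt : Z ≠ ⊤ := fun h => by
      have h0 : (0 : EuclideanSpace ℝ (Fin 2)) ∈ Z := by rw [h]; trivial
      rw [hZ] at h0
      have : J.map 0 = b iv := by simp [FaceChart.map, hb, hiv]
      rw [this, b.coord_apply_eq] at h0
      exact one_ne_zero h0
    have hnull : ∀ᵐ y, y ∉ (Z : Set (EuclideanSpace ℝ (Fin 2))) :=
      measure_eq_zero_iff_ae_notMem.1 (Measure.addHaar_affineSubspace volume Z hZt)
    have hwm : MeasurableSet {x | ENNReal.ofReal (w x) ≠ 0} :=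
      hwc.measurable.ennreal_ofReal (measurableSet_singleton 0).compl
    rw [J.faceMeasure_eq, ae_map_iff J.isometry_map.continuous.measurable.aemeasurable hwm,
      ae_restrict_iff' (J.isometry_map.continuous.measurable (measurableSet_cell F))]
    filter_upwards [hnull] with y hy hyF
    have hyK : J.map y ∈ cell K := convexHull_mono hFK hyF
    rw [hcell] at hyK
    have h1 := hyK iv
    have h2 : b.coord iv (J.map y) ≠ 0 := fun h => hy ((hZ y).2 h)
    rw [ne_eq, ENNReal.ofReal_eq_zero, not_le]
    exact lt_min (lt_of_le_of_ne h1 h2.symm) one_pos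
  · have hgm : Measurable (gradient ψ) := hψ.continuous_gradient_of_smooth.measurable
    have hψm : Measurable ψ := hψ.continuous.measurable
    have hJm : Measurable J.map := J.isometry_map.continuous.measurable
    set g : E3 → ENNReal := (cell K).indicator fun x => ‖ψ x‖ₑ + ‖e‖ₑ * ‖gradient ψ x‖ₑ with hg
    have hgmeas : Measurable g := (by fun_prop : Measurable _).indicator (measurableSet_cell K)
    calc _ = ∫⁻ y in J.map ⁻¹' cell F, ENNReal.ofReal (w (J.map y)) * ‖ψ (J.map y)‖ₑ := by
          rw [J.faceMeasure_eq, lintegral_map _ hJm]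
          exact hwc.measurable.ennreal_ofReal.mul hψm.enorm
      _ ≤ ∫⁻ y in J.map ⁻¹' cell F, ∫⁻ t : ℝ, g (J.map y + t • e) := by
          refine setLIntegral_mono' (hJm (measurableSet_cell F)) fun y hy => ?_
          refine (ofReal_mul_enorm_le hψ (J.map y) e (min_le_right _ _)).trans ?_
          refine le_trans (setLIntegral_mono' measurableSet_Icc fun t ht => ?_)
            (setLIntegral_le_lintegral (Set.Icc 0 (w (J.map y))) _)
          rw [hg, Set.indicator_of_mem (hsegm _ hy t ht)]
      _ ≤ ∫⁻ y, ∫⁻ t : ℝ, g (J.map y + t • e) := setLIntegral_le_lintegral _ _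
      _ = c * ∫⁻ x, g x := hc g hgmeas
      _ = _ := by
          rw [hg, lintegral_indicator (measurableSet_cell K), lintegral_add_left (by fun_prop),
            lintegral_const_mul _ (by fun_prop)]
          rfl

/-! ### The trace of a constant -/

lemma lintegral_enorm_le_eLpNorm_two {V : Type*} [NormedAddCommGroup V] {μ : Measure E3}
    {f : E3 → V} (hf : AEStronglyMeasurable f μ) :
    ∫⁻ x, ‖f x‖ₑ ∂μ ≤ eLpNorm f 2 μ * μ Set.univ ^ (1 / 2 : ℝ) := by
  have := eLpNorm_le_eLpNorm_mul_rpow_measure_univ (p := 1) (q := 2) (by norm_num) hf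
  rw [eLpNorm_one_eq_lintegral_enorm] at this
  convert this using 3
  norm_num

lemma tendsto_lintegral_enorm_of_eLpNorm_two {V : Type*} [NormedAddCommGroup V] {μ : Measure E3}
    [IsFiniteMeasure μ] {f : ℕ → E3 → V} (hf : ∀ n, AEStronglyMeasurable (f n) μ)
    (h : Tendsto (fun n => eLpNorm (f n) 2 μ) atTop (𝓝 0)) :
    Tendsto (fun n => ∫⁻ x, ‖f n x‖ₑ ∂μ) atTop (𝓝 0) := by
  have hc : Tendsto (fun n => eLpNorm (f n) 2 μ * μ Set.univ ^ (1 / 2 : ℝ)) atTop (𝓝 0) := by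
    have := ENNReal.Tendsto.mul_const (b := μ Set.univ ^ (1 / 2 : ℝ)) h
      (Or.inr (ENNReal.rpow_ne_top_of_nonneg (by norm_num) (measure_ne_top μ _)))
    simpa using this
  exact tendsto_of_tendsto_of_tendsto_of_le_of_le tendsto_const_nhds hc (fun _ => zero_le)
    fun n => lintegral_enorm_le_eLpNorm_two (hf n)

lemma weakGrad_const_ae_eq {U : Set E3} (hU : IsOpen U) (hb : Bornology.IsBounded U) (c : ℝ) :
    weakGrad U (fun _ => c) =ᵐ[volume.restrict U] fun _ => 0 := by
  have := (isWeakGradient_gradient (contDiff_const (c := c)) hb).weakGrad_ae_eq hU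
  rwa [gradient_fun_const'] at this

/-- The trace of the constant function `1` on a face is `1`. -/
lemma faceTrace_one_ae_eq {T : Finset (Finset E3)} {K F : Finset E3} (hKT : K ∈ T) (hK : K.card = 4)
    (hKi : AffineIndependent ℝ ((↑) : K → E3)) (hFK : F ⊆ K) (hF : F.card = 3) :
    faceTrace (patchDomain T) F (fun _ => 1) =ᵐ[faceMeasure F] fun _ => 1 := by
  obtain ⟨hfin, w, c, c', hwm, hw1, hw0, hw⟩ := exists_weighted_trace_inequality hK hKi hFK hF
  have hgrad := weakGrad_const_ae_eq (isOpen_patchDomain T) (isBounded_patchDomain T) 1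
  -- The constant sequence shows that some trace exists, so `faceTrace` is not its default value.
  -- What remains is uniqueness for the chosen `g`.
  have hex : ∃ g : E3 → ℝ, IsFaceTrace (patchDomain T) F (fun _ => 1) g := by
    refine ⟨fun _ => 1, memLp_const 1, fun _ _ => 1, fun _ => contDiff_const, ?_, ?_, ?_⟩
    · simp
    · refine tendsto_const_nhds.congr fun n => ?_
      symm
      rw [eLpNorm_congr_ae (g := fun _ => (0 : E3)) (by
        filter_upwards [hgrad] with x hx
        rw [hx, gradient_fun_const, sub_zero])]
      simp
    · simp
  rw [faceTrace, dif_pos hex]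
  obtain ⟨hg, φ, hφ, h1, h2, h3⟩ := hex.choose_spec
  set g := hex.choose
  have hψ : ∀ n, ContDiff ℝ ∞ fun x => φ n x - 1 := fun n => (hφ n).sub contDiff_const
  have hψg : ∀ n, gradient (fun x => φ n x - 1) = gradient (φ n) := fun n => by
    ext1 x
    simp only [gradient]
    rw [fderiv_sub_const]
  have hμ : volume.restrict (cell K) ≤ volume.restrict (patchDomain T) := by
    rw [restrict_cell_eq]
    exact Measure.restrict_mono (interior_cell_subset_patchDomain hKT) le_rfl
  have hKf : IsFiniteMeasure (volume.restrict (cell K)) :=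
    ⟨by simpa using (isCompact_cell K).measure_lt_top⟩
  have hφm : ∀ n, Measurable (φ n) := fun n => (hφ n).continuous.measurable
  have l1 : Tendsto (fun n => ∫⁻ x in cell K, ‖φ n x - 1‖ₑ) atTop (𝓝 0) := by
    refine tendsto_lintegral_enorm_of_eLpNorm_two
      (fun n => ((hφm n).sub_const 1).aestronglyMeasurable) ?_
    exact tendsto_of_tendsto_of_tendsto_of_le_of_le tendsto_const_nhds h1 (fun _ => zero_le)
      fun n => eLpNorm_mono_measure _ hμ
  have l2 : Tendsto (fun n => ∫⁻ x in cell K, ‖gradient (fun x => φ n x - 1) x‖ₑ) atTop (𝓝 0) := by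
    simp only [hψg]
    refine tendsto_lintegral_enorm_of_eLpNorm_two
      (fun n => (hφ n).continuous_gradient_of_smooth.measurable.aestronglyMeasurable) ?_
    refine tendsto_of_tendsto_of_tendsto_of_le_of_le tendsto_const_nhds h2 (fun _ => zero_le)
      fun n => (eLpNorm_mono_measure _ hμ).trans (le_of_eq ?_)
    refine eLpNorm_congr_ae ?_
    filter_upwards [hgrad] with x hx
    rw [hx, sub_zero]
  have l3 : Tendsto (fun n => ∫⁻ x, ‖φ n x - g x‖ₑ ∂(faceMeasure F)) atTop (𝓝 0) :=
    tendsto_lintegral_enorm_of_eLpNorm_two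
      (fun n => (hφm n).aestronglyMeasurable.sub hg.1) h3
  -- The weighted inequality applied to `φ n - 1` bounds the weighted distance from `g` to `1` by
  -- quantities tending to zero; the weight is positive almost everywhere, so `g = 1`.
  have hbound : ∀ n, ∫⁻ x, w x * ‖g x - 1‖ₑ ∂(faceMeasure F) ≤
      c * ((∫⁻ x in cell K, ‖φ n x - 1‖ₑ) +
        c' * ∫⁻ x in cell K, ‖gradient (fun x => φ n x - 1) x‖ₑ) +
      ∫⁻ x, ‖φ n x - g x‖ₑ ∂(faceMeasure F) := fun n => by
    have hm : Measurable fun x => w x * ‖φ n x - 1‖ₑ := hwm.mul ((hφm n).sub_const 1).enorm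
    calc _ ≤ ∫⁻ x, (w x * ‖φ n x - 1‖ₑ + ‖φ n x - g x‖ₑ) ∂(faceMeasure F) := by
          refine lintegral_mono fun x => ?_
          calc w x * ‖g x - 1‖ₑ = w x * ‖(φ n x - 1) - (φ n x - g x)‖ₑ := by
                rw [sub_sub_sub_cancel_left]
            _ ≤ w x * (‖φ n x - 1‖ₑ + ‖φ n x - g x‖ₑ) := by gcongr; exact enorm_sub_le
            _ ≤ _ := by
                rw [mul_add]
                gcongr
                exact mul_le_of_le_one_left' (hw1 x)
      _ ≤ _ := by
          rw [lintegral_add_left hm]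
          gcongr
          exact hw _ (hψ n)
  have hlim : Tendsto (fun n => c * ((∫⁻ x in cell K, ‖φ n x - 1‖ₑ) +
        c' * ∫⁻ x in cell K, ‖gradient (fun x => φ n x - 1) x‖ₑ) +
      ∫⁻ x, ‖φ n x - g x‖ₑ ∂(faceMeasure F)) atTop (𝓝 0) := by
    have l2' := ENNReal.Tendsto.const_mul (a := (c' : ENNReal)) l2 (Or.inr ENNReal.coe_ne_top)
    have := (ENNReal.Tendsto.const_mul (a := (c : ENNReal)) (l1.add l2')
      (Or.inr ENNReal.coe_ne_top)).add l3
    simpa using this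
  have hzero : ∫⁻ x, w x * ‖g x - 1‖ₑ ∂(faceMeasure F) = 0 :=
    le_antisymm (ge_of_tendsto' hlim hbound) zero_le
  have hm : AEMeasurable (fun x => w x * ‖g x - 1‖ₑ) (faceMeasure F) :=
    hwm.aemeasurable.mul (hg.1.sub aestronglyMeasurable_const).enorm
  rw [lintegral_eq_zero_iff' hm] at hzero
  filter_upwards [hzero, hw0] with x hx hwx
  have : ‖g x - 1‖ₑ = 0 := by simpa [hwx] using hx
  rw [enorm_eq_zero, sub_eq_zero] at this
  exact this

/-- The face pairing with the constant function `1`. -/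
lemma IsInteriorPatch.facePairing_one {a : E3} {T : Finset (Finset E3)} (hT : IsInteriorPatch a T)
    (rF : Finset E3 → E3 → ℝ) :
    facePairing T rF (fun _ => 1) = ∑ F ∈ patchFaces T, ∫ x, rF F x ∂(faceMeasure F) := by
  classical
  refine Finset.sum_congr rfl fun F hF => ?_
  obtain ⟨K, hK, hFK⟩ := Finset.mem_biUnion.1 hF
  rw [Finset.mem_powersetCard] at hFK
  refine integral_congr_ae ?_
  filter_upwards [faceTrace_one_ae_eq hK (hT.card_eq K hK) (hT.nondegenerate K hK) hFK.1 hFK.2]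
    with x hx
  rw [hx, mul_one]

/-! ### Hilbert space formulation -/

lemma lintegral_enorm_sq_eq {V : Type*} [NormedAddCommGroup V] {μ : Measure E3} (f : E3 → V) :
    ∫⁻ x, ‖f x‖ₑ ^ 2 ∂μ = eLpNorm f 2 μ ^ 2 := by
  have := eLpNorm_nnreal_pow_eq_lintegral (f := f) (μ := μ) (p := 2) two_ne_zero
  simpa using this.symm

lemma inner_toLp_eq {V : Type*} [NormedAddCommGroup V] [InnerProductSpace ℝ V]
    {μ : Measure E3} {f g : E3 → V} (hf : MemLp f 2 μ) (hg : MemLp g 2 μ) :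
    inner ℝ (hf.toLp f) (hg.toLp g) = ∫ x, inner ℝ (f x) (g x) ∂μ := by
  rw [L2.inner_def]
  refine integral_congr_ae ?_
  filter_upwards [hf.coeFn_toLp, hg.coeFn_toLp] with x h1 h2
  rw [h1, h2]

lemma abs_integral_inner_le_l2norm {U : Set E3} {f g : E3 → E3}
    (hf : MemLp f 2 (volume.restrict U)) (hg : MemLp g 2 (volume.restrict U)) :
    |∫ x in U, inner ℝ (f x) (g x)| ≤ l2norm U f * l2norm U g := by
  rw [← inner_toLp_eq hf hg, l2norm, l2norm, ← Lp.norm_toLp f hf, ← Lp.norm_toLp g hg]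
  exact abs_real_inner_le_norm _ _

lemma integral_inner_self_eq_l2norm {U : Set E3} {f : E3 → E3}
    (hf : MemLp f 2 (volume.restrict U)) :
    ∫ x in U, inner ℝ (f x) (f x) = l2norm U f ^ 2 := by
  rw [← inner_toLp_eq hf hf, l2norm, ← Lp.norm_toLp f hf, real_inner_self_eq_norm_sq]

/-- The Hilbert space of pairs of an `L²` function and an `L²` field on `U`. -/
abbrev L2Pair (U : Set E3) : Type :=
  WithLp 2 (Lp ℝ 2 ((volume : Measure E3).restrict U) × Lp E3 2 ((volume : Measure E3).restrict U))

/-- The pairs to which a zero-mean function together with its weak gradient is orthogonal. -/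
def gradientTestPairs (U : Set E3) : Set (L2Pair U) :=
  {x | ∃ (f : E3 → ℝ) (F : E3 → E3) (hf : MemLp f 2 (volume.restrict U))
      (hF : MemLp F 2 (volume.restrict U)),
    ((∃ (φ : E3 → ℝ) (e : E3), IsTestFunction U φ ∧ f = (fun y => inner ℝ e (gradient φ y)) ∧
      F = fun y => φ y • e) ∨ (f = (fun _ => 1) ∧ F = fun _ => 0)) ∧
    x = WithLp.toLp 2 (hf.toLp f, hF.toLp F)}

/-- The space of zero-mean `H¹(U)` functions, as pairs of a function and its weak gradient. -/
noncomputable def gradientGraph (U : Set E3) : Submodule ℝ (L2Pair U) :=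
  (Submodule.span ℝ (gradientTestPairs U))ᗮ

lemma mem_gradientGraph_iff_forall {U : Set E3} (x : L2Pair U) :
    x ∈ gradientGraph U ↔ ∀ y ∈ gradientTestPairs U, inner ℝ y x = 0 := by
  rw [gradientGraph, Submodule.mem_orthogonal]
  refine ⟨fun h y hy => h y (Submodule.subset_span hy), fun h y hy => ?_⟩
  induction hy using Submodule.span_induction with
  | mem y hy => exact h y hy
  | zero => exact inner_zero_left _
  | add a b _ _ ha hb => rw [inner_add_left, ha, hb, add_zero]
  | smul c a _ ha => rw [inner_smul_left, ha, mul_zero]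

/-- Orthogonality to the first kind of test pair is the weak-gradient identity paired with `e`;
orthogonality to `(1, 0)` is zero mean. Describing the space as an orthogonal complement makes its
completeness automatic. -/
lemma toLp_mem_gradientGraph_iff {U : Set E3} (hU : Bornology.IsBounded U) {v : E3 → ℝ}
    {G : E3 → E3} (hv : MemLp v 2 (volume.restrict U)) (hG : MemLp G 2 (volume.restrict U)) :
    (WithLp.toLp 2 (hv.toLp v, hG.toLp G) : L2Pair U) ∈ gradientGraph U ↔
      IsWeakGradient U v G ∧ ∫ x in U, v x = 0 := by
  have hfin : IsFiniteMeasure (volume.restrict U) := ⟨by simpa using hU.measure_lt_top⟩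
  have key : ∀ φ (e : E3), IsTestFunction U φ →
      ((∫ x in U, inner ℝ (inner ℝ e (gradient φ x)) (v x)) + ∫ x in U, inner ℝ (φ x • e) (G x)) =
        inner ℝ e ((∫ x in U, v x • gradient φ x) + ∫ x in U, φ x • G x) := fun φ e hφ => by
    rw [inner_add_right, ← integral_inner (hv.integrable_smul_two (hφ.memLp_gradient 2 _)),
      ← integral_inner ((hφ.memLp 2 _).integrable_smul_two hG)]
    congr 1 <;> refine integral_congr_ae (Eventually.of_forall fun x => ?_)
    · simp [inner_smul_right]
    · simp [inner_smul_right, inner_smul_left]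
  rw [mem_gradientGraph_iff_forall]
  constructor
  · intro h
    refine ⟨⟨hG, fun φ hφ => ?_⟩, ?_⟩
    · rw [← add_eq_zero_iff_eq_neg]
      refine ext_inner_left ℝ fun e => ?_
      have h1 : MemLp (fun y => inner ℝ e (gradient φ y)) 2 (volume.restrict U) :=
        (hφ.memLp_gradient 2 _).const_inner e
      have h2 : MemLp (fun y => φ y • e) 2 (volume.restrict U) := by
        exact (hφ.1.continuous.smul continuous_const).memLp_of_hasCompactSupport
          hφ.2.1.smul_right
      have := h _ ⟨_, _, h1, h2, Or.inl ⟨φ, e, hφ, rfl, rfl⟩, rfl⟩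
      rw [WithLp.prod_inner_apply] at this
      simp only at this
      rw [inner_toLp_eq h1 hv, inner_toLp_eq h2 hG, key φ e hφ] at this
      rw [this, inner_zero_right]
    · have h1 : MemLp (fun _ : E3 => (1 : ℝ)) 2 (volume.restrict U) := memLp_const 1
      have h2 : MemLp (fun _ : E3 => (0 : E3)) 2 (volume.restrict U) := MemLp.zero'
      have := h _ ⟨_, _, h1, h2, Or.inr ⟨rfl, rfl⟩, rfl⟩
      rw [WithLp.prod_inner_apply] at this
      simp only at this
      rw [inner_toLp_eq h1 hv, inner_toLp_eq h2 hG] at this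
      simpa using this
  · rintro ⟨h, h0⟩ y ⟨f, F, hf, hF, hfF, rfl⟩
    rw [WithLp.prod_inner_apply]
    simp only
    rw [inner_toLp_eq hf hv, inner_toLp_eq hF hG]
    rcases hfF with ⟨φ, e, hφ, rfl, rfl⟩ | ⟨rfl, rfl⟩
    · rw [key φ e hφ, h.2 φ hφ, neg_add_cancel, inner_zero_right]
    · simpa using h0

lemma mem_gradientGraph_iff {U : Set E3} (hU : Bornology.IsBounded U) (x : L2Pair U) :
    x ∈ gradientGraph U ↔ IsWeakGradient U x.fst x.snd ∧ ∫ y in U, x.fst y = 0 := by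
  rw [← toLp_mem_gradientGraph_iff hU (Lp.memLp x.fst) (Lp.memLp x.snd)]
  simp only [Lp.toLp_coeFn]
  rfl

/-- The Lax–Milgram theorem for the second component on a subspace of a product where it controls
the first component. -/
lemma exists_forall_inner_snd_eq {H₁ H₂ : Type*} [NormedAddCommGroup H₁] [InnerProductSpace ℝ H₁]
    [NormedAddCommGroup H₂] [InnerProductSpace ℝ H₂]
    (W : Submodule ℝ (WithLp 2 (H₁ × H₂))) [CompleteSpace W] {C : ℝ} (hC : 0 ≤ C)
    (hP : ∀ x ∈ W, ‖x.fst‖ ^ 2 ≤ C * ‖x.snd‖ ^ 2) (a : H₁) (b : H₂) :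
    ∃ u ∈ W, ∀ y ∈ W, inner ℝ u.snd y.snd = inner ℝ a y.fst - inner ℝ b y.snd := by
  let P : W →L[ℝ] H₂ := (WithLp.sndL 2 ℝ H₁ H₂).comp W.subtypeL
  have hPa : ∀ x : W, P x = (x : WithLp 2 (H₁ × H₂)).snd := fun _ => rfl
  let B : W →L[ℝ] W →L[ℝ] ℝ := (innerSL ℝ).bilinearComp P P
  have hB : ∀ x y : W, B x y = inner ℝ (P x) (P y) := fun _ _ => rfl
  have hcoer : IsCoercive B := by
    -- The squared norm is the sum of the two squared components, at most `(1 + C) * ‖x.snd‖ ^ 2` by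
    -- the Poincaré hypothesis.
    refine ⟨(1 + C)⁻¹, by positivity, fun x => ?_⟩
    have h1 := hP x x.2
    rw [hB, hPa, real_inner_self_eq_norm_sq, mul_assoc, ← sq, Submodule.coe_norm,
      WithLp.prod_norm_sq_eq_of_L2, inv_mul_le_iff₀ (by positivity)]
    linarith
  let ℓ : W →L[ℝ] ℝ := (innerSL ℝ (WithLp.toLp 2 (a, -b))).comp W.subtypeL
  set u : W := hcoer.continuousLinearEquivOfBilin.symm ((InnerProductSpace.toDual ℝ W).symm ℓ)
    with hu
  refine ⟨u, u.2, fun y hy => ?_⟩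
  have huB : B u ⟨y, hy⟩ = ℓ ⟨y, hy⟩ := by
    rw [← hcoer.continuousLinearEquivOfBilin_apply, hu, ContinuousLinearEquiv.apply_symm_apply,
      InnerProductSpace.toDual_symm_apply]
  rw [hB, hPa, hPa] at huB
  refine huB.trans ?_
  change inner ℝ (WithLp.toLp 2 (a, -b)) y = _
  rw [WithLp.prod_inner_apply]
  simp only
  rw [inner_neg_left, ← sub_eq_add_neg]
  rfl

/-- Solvability of the weak Neumann problem on a domain with a Poincaré inequality. -/
lemma exists_neumann_solution {U : Set E3} (hU : Bornology.IsBounded U) {C : ENNReal} (hC : C ≠ ⊤)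
    (hP : ∀ (v : E3 → ℝ) (G : E3 → E3), MemLp v 2 (volume.restrict U) →
      IsWeakGradient U v G → ∫ x in U, v x = 0 →
      ∫⁻ x in U, ‖v x‖ₑ ^ 2 ≤ C * ∫⁻ x in U, ‖G x‖ₑ ^ 2)
    {f : E3 → ℝ} {τ : E3 → E3} (hf : MemLp f 2 (volume.restrict U))
    (hτ : MemLp τ 2 (volume.restrict U)) :
    ∃ (r : E3 → ℝ) (R : E3 → E3), MemLp r 2 (volume.restrict U) ∧ IsWeakGradient U r R ∧
      ∫ x in U, r x = 0 ∧
      ∀ (v : E3 → ℝ) (G : E3 → E3), MemLp v 2 (volume.restrict U) →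
        IsWeakGradient U v G → ∫ x in U, v x = 0 →
        ∫ x in U, inner ℝ (R x) (G x) =
          (∫ x in U, f x * v x) - ∫ x in U, inner ℝ (τ x) (G x) := by
  have hWc : CompleteSpace (gradientGraph U) :=
    inferInstanceAs (CompleteSpace (Submodule.span ℝ _)ᗮ)
  have hpoin : ∀ x ∈ gradientGraph U, ‖x.fst‖ ^ 2 ≤ C.toReal * ‖x.snd‖ ^ 2 := fun x hxm => by
    have hx := (mem_gradientGraph_iff hU _).1 hxm
    have := hP _ _ (Lp.memLp x.fst) hx.1 hx.2
    rw [lintegral_enorm_sq_eq, lintegral_enorm_sq_eq] at this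
    rw [Lp.norm_def, Lp.norm_def, ← ENNReal.toReal_pow, ← ENNReal.toReal_pow, ← ENNReal.toReal_mul]
    exact ENNReal.toReal_mono (ENNReal.mul_ne_top hC (ENNReal.pow_ne_top (Lp.eLpNorm_ne_top _))) this
  obtain ⟨u, huW, hu⟩ := exists_forall_inner_snd_eq (gradientGraph U) ENNReal.toReal_nonneg hpoin
    (hf.toLp f) (hτ.toLp τ)
  have hum := (mem_gradientGraph_iff hU _).1 huW
  refine ⟨u.fst, u.snd, Lp.memLp _, hum.1, hum.2, fun v G hv hG h0 => ?_⟩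
  have : inner ℝ u.snd (hG.1.toLp G) =
      inner ℝ (hf.toLp f) (hv.toLp v) - inner ℝ (hτ.toLp τ) (hG.1.toLp G) :=
    hu _ ((toLp_mem_gradientGraph_iff hU hv hG.1).2 ⟨hG, h0⟩)
  rw [inner_toLp_eq hf hv, inner_toLp_eq hτ hG.1] at this
  have h2 : inner ℝ u.snd (hG.1.toLp G) = ∫ x in U, inner ℝ (u.snd x) (G x) := by
    rw [← inner_toLp_eq (Lp.memLp _) hG.1, Lp.toLp_coeFn]
  rw [← h2, this]
  simp [mul_comm]

/-! ### Data on patches -/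

lemma MeasureTheory.MemLp.integrable_mul_two {μ : Measure E3} {f g : E3 → ℝ} (hf : MemLp f 2 μ)
    (hg : MemLp g 2 μ) : Integrable (fun x => f x * g x) μ := hf.integrable_smul_two hg

lemma memLp_two_finsetSum_measure {ι V : Type*} [NormedAddCommGroup V] {T : Finset ι}
    {μ : ι → Measure E3} {f : E3 → V} (h : ∀ i ∈ T, MemLp f 2 (μ i)) :
    MemLp f 2 (∑ i ∈ T, μ i) := by
  classical
  constructor
  · induction T using Finset.induction_on with
    | empty => simp
    | insert i T hi ih =>
      rw [Finset.sum_insert hi, aestronglyMeasurable_add_measure_iff]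
      exact ⟨(h i (Finset.mem_insert_self i T)).1, ih fun j hj => h j (Finset.mem_insert_of_mem hj)⟩
  · have h2 : eLpNorm f 2 (∑ i ∈ T, μ i) ^ 2 < ⊤ := by
      rw [← lintegral_enorm_sq_eq, lintegral_finsetSum_measure, ENNReal.sum_lt_top]
      intro i hi
      rw [lintegral_enorm_sq_eq]
      exact ENNReal.pow_lt_top (h i hi).2
    by_contra hcon
    rw [not_lt, top_le_iff] at hcon
    simp [hcon] at h2

lemma IsPolyOn.exists_continuous {p : ℕ} {S : Set E3} {f : E3 → ℝ} (h : IsPolyOn p S f) :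
    ∃ g : E3 → ℝ, Continuous g ∧ ∀ x ∈ S, f x = g x := by
  obtain ⟨P, -, hP⟩ := h
  refine ⟨fun x => MvPolynomial.eval (fun i => x i) P, ?_, hP⟩
  have h1 : Continuous fun x : E3 => (fun i => x i : Fin 3 → ℝ) := by fun_prop
  exact (MvPolynomial.continuous_eval P).comp h1

lemma isBounded_interior_cell (K : Finset E3) : Bornology.IsBounded (interior (cell K)) :=
  (isCompact_cell K).isBounded.subset interior_subset

lemma IsPolyOn.memLp {p : ℕ} {K : Finset E3} {f : E3 → ℝ} (h : IsPolyOn p (cell K) f) :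
    MemLp f 2 (volume.restrict (cell K)) := by
  obtain ⟨g, hg, hfg⟩ := h.exists_continuous
  refine (memLp_congr_ae ?_).1 (hg.memLp_restrict_of_isBounded (isCompact_cell K).isBounded 2)
  rw [EventuallyEq, ae_restrict_iff' (measurableSet_cell K)]
  exact Eventually.of_forall fun x hx => (hfg x hx).symm

lemma IsBrokenRTN.memLp {p : ℕ} {T : Finset (Finset E3)} {τ : E3 → E3} (h : IsBrokenRTN p T τ) :
    MemLp τ 2 (volume.restrict (patchDomain T)) := by
  refine MemLp.mono_measure (restrict_patchDomain_le T) (memLp_two_finsetSum_measure fun K hK => ?_)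
  obtain ⟨q, s, hq, hs, hτ⟩ := h K hK
  choose q' hq'c hq' using fun i => (hq i).exists_continuous
  obtain ⟨s', hs'c, hs'⟩ := hs.exists_continuous
  have hc : Continuous fun x : E3 => (WithLp.toLp 2 fun i => q' i x + s' x * x i : E3) := by
    refine (PiLp.continuous_toLp 2 _).comp (continuous_pi fun i => ?_)
    exact (hq'c i).add (hs'c.mul (by fun_prop))
  refine (memLp_congr_ae ?_).1 (hc.memLp_restrict_of_isBounded (isBounded_interior_cell K) 2)
  rw [EventuallyEq, ae_restrict_iff' isOpen_interior.measurableSet]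
  refine Eventually.of_forall fun x hx => ?_
  ext i
  rw [hτ x hx i, hq' i x hx, hs' x hx]

lemma memLp_indicator_interior_cell {T : Finset (Finset E3)} {K : Finset E3} (hK : K ∈ T)
    {f : E3 → ℝ} (hf : MemLp f 2 (volume.restrict (interior (cell K)))) :
    MemLp ((interior (cell K)).indicator f) 2 (volume.restrict (patchDomain T)) := by
  rw [memLp_indicator_iff_restrict isOpen_interior.measurableSet,
    Measure.restrict_restrict_of_subset (interior_cell_subset_patchDomain hK)]
  exact hf

lemma memLp_brokenDiv (T : Finset (Finset E3)) (τ : E3 → E3) :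
    MemLp (brokenDiv T τ) 2 (volume.restrict (patchDomain T)) :=
  memLp_finsetSum T fun _ hK => memLp_indicator_interior_cell hK (memLp_weakDiv _ _)

/-- The piecewise defined volume data, glued along the elements of the patch. -/
noncomputable def gluedData (T : Finset (Finset E3)) (rK : Finset E3 → E3 → ℝ) : E3 → ℝ :=
  fun x => ∑ K ∈ T, (interior (cell K)).indicator (rK K) x

lemma memLp_gluedData {p : ℕ} {T : Finset (Finset E3)} {rK : Finset E3 → E3 → ℝ}
    (hrK : ∀ K ∈ T, IsPolyOn p (cell K) (rK K)) :
    MemLp (gluedData T rK) 2 (volume.restrict (patchDomain T)) :=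
  memLp_finsetSum T fun K hK =>
    memLp_indicator_interior_cell hK (by rw [← restrict_cell_eq]; exact (hrK K hK).memLp)

lemma integral_gluedData_mul {p : ℕ} {T : Finset (Finset E3)} {rK : Finset E3 → E3 → ℝ}
    (hrK : ∀ K ∈ T, IsPolyOn p (cell K) (rK K)) {v : E3 → ℝ}
    (hv : MemLp v 2 (volume.restrict (patchDomain T))) :
    ∫ x in patchDomain T, gluedData T rK x * v x = ∑ K ∈ T, ∫ x in cell K, rK K x * v x := by
  simp only [gluedData, Finset.sum_mul]
  rw [integral_finsetSum]
  · refine Finset.sum_congr rfl fun K hK => ?_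
    rw [restrict_cell_eq, ← Measure.restrict_restrict_of_subset (interior_cell_subset_patchDomain hK),
      ← integral_indicator isOpen_interior.measurableSet]
    refine integral_congr_ae (Eventually.of_forall fun x => ?_)
    by_cases hx : x ∈ interior (cell K) <;> simp [hx]
  · intro K hK
    exact (memLp_indicator_interior_cell hK
      (by rw [← restrict_cell_eq]; exact (hrK K hK).memLp)).integrable_mul_two hv

/-- Distinct cells overlap in a null set, so almost everywhere on `K` only one term of the sum
survives. -/
lemma IsInteriorPatch.gluedData_ae_eq {a : E3} {T : Finset (Finset E3)} (hT : IsInteriorPatch a T)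
    (rK : Finset E3 → E3 → ℝ) {K : Finset E3} (hK : K ∈ T) :
    gluedData T rK =ᵐ[volume.restrict (cell K)] rK K := by
  have hnot : ∀ᵐ x, ∀ L ∈ T, K ≠ L → x ∉ cell K ∩ cell L := by
    refine (eventually_all_finset T).2 fun L hL => ?_
    by_cases hKL : K = L
    · simp [hKL]
    · filter_upwards [measure_eq_zero_iff_ae_notMem.1 (hT.volume_inter_eq_zero hK hL hKL)]
        with x hx _ using hx
  rw [restrict_cell_eq, EventuallyEq, ae_restrict_iff' isOpen_interior.measurableSet]
  filter_upwards [hnot] with x hx hxK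
  rw [gluedData, Finset.sum_eq_single_of_mem K hK, Set.indicator_of_mem hxK]
  intro L hL hLK
  exact Set.indicator_of_notMem
    (fun hxL => hx L hL hLK.symm ⟨interior_subset hxK, interior_subset hxL⟩) _

lemma ae_restrict_patchDomain_of_cells {T : Finset (Finset E3)} {p : E3 → Prop}
    (h : ∀ K ∈ T, ∀ᵐ x ∂(volume.restrict (cell K)), p x) :
    ∀ᵐ x ∂(volume.restrict (patchDomain T)), p x := by
  refine Measure.restrict_mono (μ := volume) (ν := volume) (interior_subset (s := ⋃ K ∈ T, cell K))
    le_rfl |>.absolutelyContinuous.ae_le ?_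
  exact (ae_restrict_biUnion_finset_iff cell T p).2 h

lemma ae_restrict_cell_of_patchDomain {T : Finset (Finset E3)} {K : Finset E3} (hK : K ∈ T)
    {p : E3 → Prop} (h : ∀ᵐ x ∂(volume.restrict (patchDomain T)), p x) :
    ∀ᵐ x ∂(volume.restrict (cell K)), p x := by
  rw [restrict_cell_eq]
  exact (Measure.restrict_mono (interior_cell_subset_patchDomain hK) le_rfl).absolutelyContinuous.ae_le h

/-! ### The residual -/

section Residual

variable {a : E3} {T : Finset (Finset E3)} {p : ℕ} {rK rF : Finset E3 → E3 → ℝ} {τ : E3 → E3}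

/-- Green's formula trades the face pairing for volume integrals; from here on the residual is
handled as an `L²` functional of `v` and its gradient. -/
lemma patchResidual_eq (hrK : ∀ K ∈ T, IsPolyOn p (cell K) (rK K)) (hτr : HasNormalData T rF τ)
    {v : E3 → ℝ} (hv : MemH1 (patchDomain T) v) :
    patchResidual T rK rF v =
      (∫ x in patchDomain T, (gluedData T rK x - brokenDiv T τ x) * v x) -
        ∫ x in patchDomain T, inner ℝ (τ x) (weakGrad (patchDomain T) v x) := by
  rw [patchResidual, ← hτr v hv, ← integral_gluedData_mul hrK hv.1]
  simp only [sub_mul]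
  rw [integral_sub ((memLp_gluedData hrK).integrable_mul_two hv.1)
    ((memLp_brokenDiv T τ).integrable_mul_two hv.1)]
  ring

lemma memH1_const (T : Finset (Finset E3)) (c : ℝ) : MemH1 (patchDomain T) fun _ => c :=
  memH1_of_contDiff contDiff_const (isBounded_patchDomain T)

/-- Test with `v = 1`: the gradient term drops out, and since the trace of `1` is `1` the residual
is exactly the compatibility sum. -/
lemma IsInteriorPatch.integral_data_eq_zero (hT : IsInteriorPatch a T)
    (hrK : ∀ K ∈ T, IsPolyOn p (cell K) (rK K)) (hτr : HasNormalData T rF τ)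
    (hcomp : (∑ K ∈ T, ∫ x in cell K, rK K x) -
      ∑ F ∈ patchFaces T, ∫ x, rF F x ∂(faceMeasure F) = 0) :
    ∫ x in patchDomain T, (gluedData T rK x - brokenDiv T τ x) = 0 := by
  have h1 := patchResidual_eq hrK hτr (memH1_const T 1)
  have h2 : ∫ x in patchDomain T, inner ℝ (τ x) (weakGrad (patchDomain T) (fun _ => 1) x) = 0 := by
    refine integral_eq_zero_of_ae ?_
    filter_upwards [weakGrad_const_ae_eq (isOpen_patchDomain T) (isBounded_patchDomain T) 1]
      with x hx
    simp [hx]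
  rw [patchResidual, hT.facePairing_one, h2, sub_zero] at h1
  simp only [mul_one] at h1
  rw [← h1, hcomp]

/-- A zero-mean solution satisfies the variational equation for all test functions in `H¹`. -/
lemma IsNeumannSolution.integral_inner_eq (hT : IsInteriorPatch a T)
    (hrK : ∀ K ∈ T, IsPolyOn p (cell K) (rK K)) (hτr : HasNormalData T rF τ)
    (hcomp : (∑ K ∈ T, ∫ x in cell K, rK K x) -
      ∑ F ∈ patchFaces T, ∫ x, rF F x ∂(faceMeasure F) = 0)
    {r : E3 → ℝ} (hr : IsNeumannSolution T rK rF r) {v : E3 → ℝ} (hv : MemH1 (patchDomain T) v) :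
    ∫ x in patchDomain T, inner ℝ (weakGrad (patchDomain T) r x) (weakGrad (patchDomain T) v x) =
      patchResidual T rK rF v := by
  set U := patchDomain T with hU
  have hUo : IsOpen U := isOpen_patchDomain T
  have hUb : Bornology.IsBounded U := isBounded_patchDomain T
  have hfin : IsFiniteMeasure (volume.restrict U) := ⟨by simpa using hUb.measure_lt_top⟩
  have hne : (volume U).toReal ≠ 0 := (ENNReal.toReal_pos
    (hUo.measure_pos volume ⟨a, hT.mem_patchDomain⟩).ne' hUb.measure_lt_top.ne).ne'
  -- Subtracting the mean makes `v` an allowed test function. The gradient is unaffected, and so is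
  -- the load since it annihilates constants.
  set c : ℝ := - ((volume U).toReal⁻¹ * ∫ x in U, v x) with hc
  have hg := hv.isWeakGradient.add hv.1 (memH1_const T c).1 (memH1_const T c).isWeakGradient
  have hvc : MemH1 U fun x => v x + c := ⟨hv.1.add (memLp_const c), _, hg⟩
  have hmean : ∫ x in U, (v x + c) = 0 := by
    rw [integral_add (hv.1.integrable one_le_two) (integrable_const c), integral_const, hc]
    simp only [Measure.real, Measure.restrict_apply MeasurableSet.univ, Set.univ_inter, smul_eq_mul]
    field_simp
    ring
  have hgrad : weakGrad U (fun x => v x + c) =ᵐ[volume.restrict U] weakGrad U v := by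
    filter_upwards [hg.weakGrad_ae_eq hUo, weakGrad_const_ae_eq hUo hUb c] with x h1 h2
    rw [h1, h2, add_zero]
  have h1 := hr.2 _ ⟨hvc, hmean⟩
  have e1 : ∫ x in U, inner ℝ (weakGrad U r x) (weakGrad U (fun x => v x + c) x) =
      ∫ x in U, inner ℝ (weakGrad U r x) (weakGrad U v x) :=
    integral_congr_ae (by filter_upwards [hgrad] with x hx; rw [hx])
  have e2 : ∫ x in U, inner ℝ (τ x) (weakGrad U (fun x => v x + c) x) =
      ∫ x in U, inner ℝ (τ x) (weakGrad U v x) :=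
    integral_congr_ae (by filter_upwards [hgrad] with x hx; rw [hx])
  have hf : MemLp (fun x => gluedData T rK x - brokenDiv T τ x) 2 (volume.restrict U) :=
    (memLp_gluedData hrK).sub (memLp_brokenDiv T τ)
  have e3 : ∫ x in U, (gluedData T rK x - brokenDiv T τ x) * (v x + c) =
      ∫ x in U, (gluedData T rK x - brokenDiv T τ x) * v x := by
    simp only [mul_add]
    rw [integral_add (hf.integrable_mul_two hv.1) ((hf.integrable one_le_two).mul_const c),
      integral_mul_const, hT.integral_data_eq_zero hrK hτr hcomp, zero_mul, add_zero]
  rw [← hU, e1, patchResidual_eq hrK hτr hvc, ← hU, e2, e3] at h1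
  rw [h1, patchResidual_eq hrK hτr hv]

lemma IsInteriorPatch.exists_isNeumannSolution (hT : IsInteriorPatch a T)
    (hrK : ∀ K ∈ T, IsPolyOn p (cell K) (rK K)) (hτ : IsBrokenRTN p T τ)
    (hτr : HasNormalData T rF τ) : ∃ r : E3 → ℝ, IsNeumannSolution T rK rF r := by
  obtain ⟨C, hC, hP⟩ := hT.poincare
  obtain ⟨r, R, hr, hR, h0, h⟩ := exists_neumann_solution (isBounded_patchDomain T) hC hP
    ((memLp_gluedData hrK).sub (memLp_brokenDiv T τ)) hτ.memLp
  refine ⟨r, ⟨⟨hr, R, hR⟩, h0⟩, fun v hv => ?_⟩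
  rw [patchResidual_eq hrK hτr hv.1]
  refine Eq.trans (integral_congr_ae ?_) (h v _ hv.1.1 hv.1.isWeakGradient hv.2)
  filter_upwards [hR.weakGrad_ae_eq (isOpen_patchDomain T)] with x hx
  rw [hx]

end Residual

/-! ### Normalized test functions and the extremal identities -/

lemma l2norm_congr_ae {V : Type*} [NormedAddCommGroup V] {U : Set E3} {f g : E3 → V}
    (h : f =ᵐ[volume.restrict U] g) : l2norm U f = l2norm U g := by
  rw [l2norm, l2norm, eLpNorm_congr_ae h]

/-- There are `H¹` functions on a patch whose gradient has norm one. -/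
lemma IsInteriorPatch.exists_l2norm_weakGrad_eq_one {a : E3} {T : Finset (Finset E3)}
    (hT : IsInteriorPatch a T) : ∃ v : E3 → ℝ, MemH1 (patchDomain T) v ∧
      l2norm (patchDomain T) (weakGrad (patchDomain T) v) = 1 := by
  set U := patchDomain T with hU
  have hUo : IsOpen U := isOpen_patchDomain T
  have hUb : Bornology.IsBounded U := isBounded_patchDomain T
  set e : E3 := EuclideanSpace.single 0 1 with he
  have hen : ‖e‖ = 1 := by simp [he]
  have hpos : 0 < l2norm U fun _ => e := by
    have h0 : volume U ≠ 0 := (hUo.measure_pos volume ⟨a, hT.mem_patchDomain⟩).ne'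
    rw [l2norm, eLpNorm_const e (by norm_num) (by simpa using h0)]
    refine ENNReal.toReal_pos ?_ ?_
    · have : e ≠ 0 := by rw [← norm_ne_zero_iff, hen]; exact one_ne_zero
      simp [h0, hUb.measure_lt_top.ne, this]
    · exact ENNReal.mul_ne_top (by simp) (ENNReal.rpow_ne_top_of_nonneg (by simp)
        (by simpa using hUb.measure_lt_top.ne))
  set m := l2norm U fun _ => e
  have hsm : ContDiff ℝ ∞ fun x : E3 => m⁻¹ * inner ℝ e x :=
    contDiff_const.mul (innerSL ℝ e).contDiff
  have hgr : gradient (fun x : E3 => m⁻¹ * inner ℝ e x) = fun _ => m⁻¹ • e := by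
    refine gradient_eq fun x => ?_
    rw [hasGradientAt_iff_hasFDerivAt]
    have h1 : HasFDerivAt (fun x : E3 => inner ℝ e x) (innerSL ℝ e) x := (innerSL ℝ e).hasFDerivAt
    have h2 : InnerProductSpace.toDual ℝ E3 (m⁻¹ • e) = m⁻¹ • innerSL ℝ e := by
      ext y
      simp
    rw [h2]
    exact h1.const_mul m⁻¹
  refine ⟨_, memH1_of_contDiff hsm hUb, ?_⟩
  have := (isWeakGradient_gradient hsm hUb).weakGrad_ae_eq hUo
  rw [l2norm_congr_ae this, hgr, l2norm,
    show (fun _ : E3 => m⁻¹ • e) = m⁻¹ • (fun _ : E3 => e) from rfl, eLpNorm_const_smul,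
    ENNReal.toReal_mul]
  change ‖m⁻¹‖ₑ.toReal * m = 1
  rw [toReal_enorm, Real.norm_of_nonneg (by positivity), inv_mul_cancel₀ hpos.ne']

theorem mainTheorem9
    (a : E3) (T : Finset (Finset E3)) (hT : IsInteriorPatch a T)
    (p : ℕ) (rK rF : Finset E3 → E3 → ℝ)
    (hrK : ∀ K ∈ T, IsPolyOn p (cell K) (rK K))
    (hrF : ∀ F ∈ patchFaces T, IsPolyOn p (cell F) (rF F))
    (hcomp : (∑ K ∈ T, ∫ x in cell K, rK K x) -
      ∑ F ∈ patchFaces T, ∫ x, rF F x ∂(faceMeasure F) = 0)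
    (τ : E3 → E3) (hτ : IsBrokenRTN p T τ) (hτr : HasNormalData T rF τ) :
    (∃ r : E3 → ℝ, IsNeumannSolution T rK rF r) ∧
    ∀ r : E3 → ℝ, IsNeumannSolution T rK rF r →
      IsLeast
        {m : ℝ | ∃ w : E3 → E3, MemHdivZeroNormal (patchDomain T) w ∧
          (∀ K ∈ T, weakDiv (patchDomain T) w =ᵐ[volume.restrict (cell K)]
            fun x => rK K x - brokenDiv T τ x) ∧
          m = l2norm (patchDomain T) (fun x => τ x + w x)}
        (l2norm (patchDomain T) (weakGrad (patchDomain T) r)) ∧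
      IsGreatest
        {m : ℝ | ∃ v : E3 → ℝ, MemH1 (patchDomain T) v ∧
          l2norm (patchDomain T) (weakGrad (patchDomain T) v) = 1 ∧
          m = patchResidual T rK rF v}
        (l2norm (patchDomain T) (weakGrad (patchDomain T) r)) := by
  refine ⟨hT.exists_isNeumannSolution hrK hτ hτr, fun r hr => ?_⟩
  set U := patchDomain T with hU
  have hUo : IsOpen U := isOpen_patchDomain T
  have hUb : Bornology.IsBounded U := isBounded_patchDomain T
  have hτL : MemLp τ 2 (volume.restrict U) := hτ.memLp
  have hr1 : MemH1 U r := hr.1.1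
  set G := weakGrad U r with hG
  have hGL : MemLp G 2 (volume.restrict U) := hr1.isWeakGradient.1
  set f : E3 → ℝ := fun x => gluedData T rK x - brokenDiv T τ x with hf
  have hfL : MemLp f 2 (volume.restrict U) := (memLp_gluedData hrK).sub (memLp_brokenDiv T τ)
  have hvar : ∀ v, MemH1 U v → ∫ x in U, inner ℝ (G x) (weakGrad U v x) =
      (∫ x in U, f x * v x) - ∫ x in U, inner ℝ (τ x) (weakGrad U v x) := fun v hv => by
    rw [← patchResidual_eq hrK hτr hv]
    exact hr.integral_inner_eq hT hrK hτr hcomp hv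
  have hres : ∀ v, MemH1 U v → patchResidual T rK rF v =
      ∫ x in U, inner ℝ (G x) (weakGrad U v x) := fun v hv =>
    (hr.integral_inner_eq hT hrK hτr hcomp hv).symm
  have hN0 : 0 ≤ l2norm U G := ENNReal.toReal_nonneg
  refine ⟨⟨?_, ?_⟩, ⟨?_, ?_⟩⟩
  · set w : E3 → E3 := fun x => - G x - τ x with hw
    have hwL : MemLp w 2 (volume.restrict U) := hGL.neg.sub hτL
    -- With test functions `v` this identifies the divergence of `w` as `f`; with all `v ∈ H¹` it is
    -- the vanishing normal trace.
    have hwint : ∀ v, MemH1 U v → ∫ x in U, inner ℝ (w x) (weakGrad U v x) =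
        - ∫ x in U, f x * v x := fun v hv => by
      have hvL := hv.isWeakGradient.1
      simp only [hw, inner_sub_left, inner_neg_left]
      have hi : Integrable (fun x => - inner ℝ (G x) (weakGrad U v x)) (volume.restrict U) :=
        (hGL.integrable_inner_two hvL).neg
      rw [integral_sub hi (hτL.integrable_inner_two hvL), integral_neg, hvar v hv]
      ring
    have hdiv : IsWeakDivergence U w f := by
      refine ⟨hfL, fun φ hφ => ?_⟩
      rw [← hwint φ (hφ.memH1 hUb)]
      refine integral_congr_ae ?_
      filter_upwards [(isWeakGradient_gradient hφ.1 hUb).weakGrad_ae_eq hUo] with x hx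
      rw [hx]
    have hdae := hdiv.weakDiv_ae_eq hUo
    refine ⟨w, ⟨⟨hwL, f, hdiv⟩, fun v hv => ?_⟩, fun K hK => ?_, ?_⟩
    · rw [hwint v hv, integral_congr_ae (g := fun x => f x * v x)
        (by filter_upwards [hdae] with x hx; rw [hx]), add_neg_cancel]
    · filter_upwards [ae_restrict_cell_of_patchDomain hK hdae, hT.gluedData_ae_eq rK hK]
        with x h1 h2
      rw [h1, hf]
      simp only [h2]
    · have : (fun x => τ x + w x) = -G := by
        ext1 x
        simp [hw]
      rw [this, l2norm, l2norm, eLpNorm_neg]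
  · rintro m ⟨w, ⟨hw, hw0⟩, hwd, rfl⟩
    have hdae : weakDiv U w =ᵐ[volume.restrict U] f := by
      refine ae_restrict_patchDomain_of_cells fun K hK => ?_
      filter_upwards [hwd K hK, hT.gluedData_ae_eq rK hK] with x h1 h2
      rw [h1, hf]
      simp only [h2]
    -- Testing the zero normal trace with `r` itself gives `(w, G) = -(f, r)`, and the variational
    -- equation then yields `(τ + w, G) = -‖G‖²` for every admissible `w`.
    have h1 := hw0 r hr1
    rw [integral_congr_ae (g := fun x => f x * r x)
      (by filter_upwards [hdae] with x hx; rw [hx])] at h1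
    have h2 := hvar r hr1
    rw [integral_inner_self_eq_l2norm hGL] at h2
    have h3 : ∫ x in U, inner ℝ (τ x + w x) (G x) =
        (∫ x in U, inner ℝ (τ x) (G x)) + ∫ x in U, inner ℝ (w x) (G x) := by
      simp only [inner_add_left]
      exact integral_add (hτL.integrable_inner_two hGL) (hw.1.integrable_inner_two hGL)
    have h4 := abs_integral_inner_le_l2norm (hτL.add hw.1) hGL
    have h5 : l2norm U G * l2norm U G ≤ l2norm U (fun x => τ x + w x) * l2norm U G := by
      refine le_trans ?_ h4
      refine le_trans (le_of_eq ?_) (neg_le_abs _)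
      change _ = -∫ x in U, inner ℝ (τ x + w x) (G x)
      rw [h3, ← sq]
      linarith
    rcases hN0.eq_or_lt with h0 | h0
    · rw [← h0]
      exact ENNReal.toReal_nonneg
    · exact le_of_mul_le_mul_right h5 h0
  · rcases hN0.eq_or_lt with h0 | h0
    -- If `G` vanishes, the residual is identically zero and any function with unit gradient norm
    -- attains the maximum.
    · obtain ⟨v, hv, hv1⟩ := hT.exists_l2norm_weakGrad_eq_one
      refine ⟨v, hv, hv1, ?_⟩
      have := abs_integral_inner_le_l2norm hGL hv.isWeakGradient.1
      rw [← h0, zero_mul, abs_nonpos_iff] at this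
      rw [hres v hv, this, ← h0]
    · have hg := hr1.isWeakGradient.const_mul (l2norm U G)⁻¹
      have hv : MemH1 U fun x => (l2norm U G)⁻¹ * r x := ⟨hr1.1.const_mul _, _, hg⟩
      have hgae := hg.weakGrad_ae_eq hUo
      refine ⟨_, hv, ?_, ?_⟩
      · rw [l2norm_congr_ae hgae]
        change l2norm U ((l2norm U G)⁻¹ • G) = 1
        rw [l2norm, eLpNorm_const_smul, ENNReal.toReal_mul, toReal_enorm,
          Real.norm_of_nonneg (inv_nonneg.2 hN0)]
        exact inv_mul_cancel₀ h0.ne'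
      · rw [hres _ hv, integral_congr_ae (g := fun x => (l2norm U G)⁻¹ * inner ℝ (G x) (G x))
          (by filter_upwards [hgae] with x hx; rw [hx, inner_smul_right]), integral_const_mul,
          integral_inner_self_eq_l2norm hGL]
        field_simp
  · rintro m ⟨v, hv, hv1, rfl⟩
    rw [hres v hv]
    have := abs_integral_inner_le_l2norm hGL hv.isWeakGradient.1
    rw [hv1, mul_one] at this
    exact (le_abs_self _).trans this
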